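/- **Theorem 4.2.** Let $A$ be a complex Banach algebra, not necessarily unital, with a left or right bounded approximate identity, i.e. there is a norm-bounded net $(e_\nu)$ in $A$ such that $e_\nu a\to a$ for all $a\in A$, or one such that $a e_\nu\to a$ for all $a\in A$. Let $I$ be a closed two-sided ideal of $A$ which is an amenable Banach algebra, i.e. for every Banach $I$-bimodule $X$, with dual bimodule $X^*$ given by $(a\cdot f)(x)=f(x\cdot a)$, $(f\cdot a)(x)=f(a\cdot x)$, every bounded linear $D:I\to X^*$ with $D(ab)=a\cdot D(b)+D(a)\cdot b$ has the form $D(a)=a\cdot f-f\cdot a$ for some $f\in X^*$. For a Banach algebra $B$ and $n\ge 0$ let $CC^n(B)$ be the Banach space of bounded $(n+1)$-linear functionals $f$ on $B$ that are cyclic, i.e. $f(a_0,\dots,a_n)=(-1)^n f(a_1,\dots,a_n,a_0)$, and let $\mathcal{HC}^n(B)$ (the Banach cyclic cohomology) be the $n$-th cohomology of the complex $0\to CC^0(B)\to CC^1(B)\to\cdots$ with differential $$(\delta^n f)(a_0,\dots,a_{n+1})=\sum_{i=0}^n(-1)^i f(a_0,\dots,a_ia_{i+1},\dots,a_{n+1})+(-1)^{n+1}f(a_{n+1}a_0,a_1,\dots,a_n),$$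 with the quotient seminorm. Let $\theta:A\to A/I$ be the quotient map, $A/I$ carrying the quotient norm. The natural map $\mathcal{HC}^n(A/I)\to\mathcal{HC}^n(A)$ is the one induced by $f\mapsto f(\theta(\cdot),\dots,\theta(\cdot))$. Then: (i) the natural map $\mathcal{HC}^n(A/I)\to\mathcal{HC}^n(A)$ is injective for all even $n\ge 0$ and surjective for all odd $n\ge 1$; (ii) if the only bounded linear functional $f$ on $I$ with $f(ab)=f(ba)$ for all $a,b\in I$ is $f=0$, then for all $n\ge 0$ the natural map $\mathcal{HC}^n(A/I)\to\mathcal{HC}^n(A)$ is a topological isomorphism of seminormed spaces. -/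

import Mathlib

open Filter Topology

noncomputable section

namespace BanachCyclic

universe u v

set_option linter.unusedSectionVars false

/-! ### Amenability -/

section Amenable

variable (B : Type u) [NonUnitalNormedRing B] [NormedSpace ℂ B]
  [IsScalarTower ℂ B B] [SMulCommClass ℂ B B]

/-- A Banach bimodule structure over the (possibly non-unital) algebra `B` on the normed space `X`:
`left a x = a · x` and `right a x = x · a` are bounded bilinear maps satisfying the bimodule
identities. -/
structure BanachBimodule (X : Type v) [NormedAddCommGroup X] [NormedSpace ℂ X] where
  left : B →L[ℂ] X →L[ℂ] X
  right : B →L[ℂ] X →L[ℂ] X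
  left_mul : ∀ (a b : B) (x : X), left (a * b) x = left a (left b x)
  right_mul : ∀ (a b : B) (x : X), right (a * b) x = right b (right a x)
  left_right : ∀ (a b : B) (x : X), right b (left a x) = left a (right b x)

variable {B}
variable {X : Type v} [NormedAddCommGroup X] [NormedSpace ℂ X]

/-- The dual bimodule: `(a · f)(x) = f(x · a)` and `(f · a)(x) = f(a · x)`. -/
def BanachBimodule.dual (m : BanachBimodule B X) : BanachBimodule B (X →L[ℂ] ℂ) where
  left := ((ContinuousLinearMap.compL ℂ X X ℂ).flip).comp m.right
  right := ((ContinuousLinearMap.compL ℂ X X ℂ).flip).comp m.left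
  left_mul a b f := by ext x; simp [m.right_mul]
  right_mul a b f := by ext x; simp [m.left_mul]
  left_right a b f := by ext x; simp [m.left_right]

theorem BanachBimodule.dual_left_apply (m : BanachBimodule B X) (a : B) (f : X →L[ℂ] ℂ) (x : X) :
    m.dual.left a f x = f (m.right a x) := rfl

theorem BanachBimodule.dual_right_apply (m : BanachBimodule B X) (a : B) (f : X →L[ℂ] ℂ) (x : X) :
    m.dual.right a f x = f (m.left a x) := rfl

/-- `D` is a `1`-cocycle: `a · D b - D (a b) + D a · b = 0`. -/
def BanachBimodule.IsOneCocycle (m : BanachBimodule B X) (D : B →L[ℂ] X) : Prop :=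
  ∀ a b : B, m.left a (D b) - D (a * b) + m.right b (D a) = 0

/-- `D` is a `1`-coboundary: `D a = a · x - x · a` for some `x`. -/
def BanachBimodule.IsOneCoboundary (m : BanachBimodule B X) (D : B →L[ℂ] X) : Prop :=
  ∃ x : X, ∀ a : B, D a = m.left a x - m.right a x

variable (B) in
/-- `B` is amenable: `H¹(B, M) = 0` for every dual Banach `B`-bimodule `M = X*`, i.e. every
bounded `1`-cocycle `B → X*` is a `1`-coboundary. -/
def IsAmenable : Prop :=
  ∀ (X : Type u) [NormedAddCommGroup X] [NormedSpace ℂ X] [CompleteSpace X]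
    (m : BanachBimodule B X) (D : B →L[ℂ] (X →L[ℂ] ℂ)),
    m.dual.IsOneCocycle D → m.dual.IsOneCoboundary D

end Amenable

/-! ### Approximate identities and traces -/

section Misc

variable (A : Type u) [NonUnitalNormedRing A]

/-- There is a norm-bounded net `e` with `e a → a` for every `a` (nets are expressed by filters). -/
def HasLeftBAI : Prop :=
  ∃ l : Filter A, l.NeBot ∧ (∃ C : ℝ, ∀ᶠ e in l, ‖e‖ ≤ C) ∧
    ∀ a : A, Tendsto (fun e => e * a) l (𝓝 a)

/-- There is a norm-bounded net `e` with `a e → a` for every `a` (nets are expressed by filters). -/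
def HasRightBAI : Prop :=
  ∃ l : Filter A, l.NeBot ∧ (∃ C : ℝ, ∀ᶠ e in l, ‖e‖ ≤ C) ∧
    ∀ a : A, Tendsto (fun e => a * e) l (𝓝 a)

variable [NormedSpace ℂ A]

/-- The only bounded trace on `A` is zero. -/
def HasNoNonzeroBoundedTrace : Prop :=
  ∀ f : A →L[ℂ] ℂ, (∀ a b : A, f (a * b) = f (b * a)) → f = 0

end Misc

/-! ### Banach cyclic cohomology -/

section CochainComplex

section Basic

variable (A : Type u) [NonUnitalNormedRing A] [NormedSpace ℂ A]

/-- The Banach space `C^n(A)` of bounded `(n+1)`-linear functionals on `A`, with the operator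
norm. -/
def Cochain (n : ℕ) : Type u := ContinuousMultilinearMap ℂ (fun _ : Fin (n + 1) => A) ℂ

instance (n : ℕ) : NormedAddCommGroup (Cochain A n) :=
  inferInstanceAs (NormedAddCommGroup (ContinuousMultilinearMap ℂ (fun _ : Fin (n + 1) => A) ℂ))

instance (n : ℕ) : NormedSpace ℂ (Cochain A n) :=
  inferInstanceAs (NormedSpace ℂ (ContinuousMultilinearMap ℂ (fun _ : Fin (n + 1) => A) ℂ))

instance (n : ℕ) : FunLike (Cochain A n) (Fin (n + 1) → A) ℂ :=
  inferInstanceAs (FunLike (ContinuousMultilinearMap ℂ (fun _ : Fin (n + 1) => A) ℂ) _ _)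

variable {A}

/-- A cochain as a continuous multilinear map; this is the identity. -/
def Cochain.toCMM {n : ℕ} (f : Cochain A n) :
    ContinuousMultilinearMap ℂ (fun _ : Fin (n + 1) => A) ℂ := f

/-- A continuous multilinear map as a cochain; this is the identity. -/
def Cochain.ofCMM {n : ℕ} (f : ContinuousMultilinearMap ℂ (fun _ : Fin (n + 1) => A) ℂ) :
    Cochain A n := f

theorem Cochain.toCMM_apply {n : ℕ} (f : Cochain A n) (a : Fin (n + 1) → A) :
    f.toCMM a = f a := rfl

theorem Cochain.ofCMM_apply {n : ℕ}
    (f : ContinuousMultilinearMap ℂ (fun _ : Fin (n + 1) => A) ℂ) (a : Fin (n + 1) → A) :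
    Cochain.ofCMM f a = f a := rfl

theorem Cochain.ext {n : ℕ} {f g : Cochain A n} (h : ∀ a, f a = g a) : f = g :=
  ContinuousMultilinearMap.ext (f := f.toCMM) (f' := g.toCMM) h

theorem Cochain.add_apply {n : ℕ} (f g : Cochain A n) (a : Fin (n + 1) → A) :
    (f + g) a = f a + g a := rfl

theorem Cochain.smul_apply {n : ℕ} (c : ℂ) (f : Cochain A n) (a : Fin (n + 1) → A) :
    (c • f) a = c * f a := rfl

theorem Cochain.sum_apply {n : ℕ} {ι : Type*} (s : Finset ι) (f : ι → Cochain A n)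
    (a : Fin (n + 1) → A) : (∑ i ∈ s, f i) a = ∑ i ∈ s, f i a :=
  map_sum (AddMonoidHom.mk' (fun g : Cochain A n => g a) fun _ _ => rfl) f s

end Basic

variable {A : Type u} [NonUnitalNormedRing A] [NormedSpace ℂ A]

/-- The operator `(t_n f)(a₀, …, aₙ) = (-1)^n f(a₁, …, aₙ, a₀)`
(addition in `Fin (n + 1)` is cyclic). -/
def cyclicOp (n : ℕ) : Cochain A n →ₗ[ℂ] Cochain A n where
  toFun f := (-1 : ℂ) ^ n •
    Cochain.ofCMM (f.toCMM.domDomCongr (Equiv.addRight (1 : Fin (n + 1))))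
  map_add' _ _ := Cochain.ext fun _ => mul_add _ _ _
  map_smul' _ _ := Cochain.ext fun _ => mul_left_comm _ _ _

theorem cyclicOp_apply (n : ℕ) (f : Cochain A n) (a : Fin (n + 1) → A) :
    cyclicOp n f a = (-1 : ℂ) ^ n * f (fun i => a (i + 1)) := rfl

/-- The space `CC^n(A)` of cyclic cochains: `t_n f = f`. -/
def cyclicCochains (A : Type u) [NonUnitalNormedRing A] [NormedSpace ℂ A] (n : ℕ) :
    Submodule ℂ (Cochain A n) :=
  LinearMap.eqLocus (cyclicOp n) LinearMap.id

theorem mem_cyclicCochains {n : ℕ} {f : Cochain A n} :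
    f ∈ cyclicCochains A n ↔ cyclicOp n f = f := Iff.rfl

variable [IsScalarTower ℂ A A] [SMulCommClass ℂ A A]

theorem contractNth_update {n : ℕ} (j : Fin (n + 1)) (i : Fin (n + 2)) (a : Fin (n + 2) → A) :
    ∃ (k : Fin (n + 1)) (L : A →ₗ[ℂ] A), ∀ x : A,
      Fin.contractNth j.castSucc (· * ·) (Function.update a i x) =
        Function.update (Fin.contractNth j.castSucc (· * ·) a) k (L x) := by
  have key : ∀ (k : Fin (n + 1)) (L : A →ₗ[ℂ] A),
      (∀ x l, Fin.contractNth j.castSucc (· * ·) (Function.update a i x) l =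
        if l = k then L x else Fin.contractNth j.castSucc (· * ·) a l) →
      ∀ x : A, Fin.contractNth j.castSucc (· * ·) (Function.update a i x) =
        Function.update (Fin.contractNth j.castSucc (· * ·) a) k (L x) := by
    intro k L h x
    funext l
    rw [h, Function.update_apply]
  by_cases h1 : (i : ℕ) < j
  · refine ⟨⟨i, by omega⟩, LinearMap.id, key _ _ fun x l => ?_⟩
    simp only [Fin.contractNth, Function.update_apply, Fin.ext_iff, LinearMap.id_apply,
      Fin.val_castSucc, Fin.val_succ]
    split_ifs <;> first | rfl | omega
  by_cases h2 : (i : ℕ) = j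
  · refine ⟨j, LinearMap.mulRight ℂ (a j.succ), key _ _ fun x l => ?_⟩
    simp only [Fin.contractNth, Function.update_apply, Fin.ext_iff, LinearMap.mulRight_apply,
      Fin.val_castSucc, Fin.val_succ]
    split_ifs <;> first | rfl | omega | (obtain rfl : l = j := Fin.ext (by assumption); rfl)
  by_cases h3 : (i : ℕ) = j + 1
  · refine ⟨j, LinearMap.mulLeft ℂ (a j.castSucc), key _ _ fun x l => ?_⟩
    simp only [Fin.contractNth, Function.update_apply, Fin.ext_iff, LinearMap.mulLeft_apply,
      Fin.val_castSucc, Fin.val_succ]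
    split_ifs <;> first | rfl | omega | (obtain rfl : l = j := Fin.ext (by assumption); rfl)
  · refine ⟨⟨i - 1, by omega⟩, LinearMap.id, key _ _ fun x l => ?_⟩
    simp only [Fin.contractNth, Function.update_apply, Fin.ext_iff, LinearMap.id_apply,
      Fin.val_castSucc, Fin.val_succ]
    split_ifs <;> first | rfl | omega

theorem continuous_contractNth {n : ℕ} (j : Fin (n + 2)) :
    Continuous (fun a : Fin (n + 2) → A => Fin.contractNth j (· * ·) a) := by
  refine continuous_pi fun k => ?_
  unfold Fin.contractNth
  split_ifs <;> fun_prop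

/-- `f(a₀, …, a_j a_{j+1}, …, a_{n+1})` as a cochain of degree `n + 1`, for `0 ≤ j ≤ n`. -/
def face {n : ℕ} (j : Fin (n + 1)) (f : Cochain A n) : Cochain A (n + 1) :=
  Cochain.ofCMM
    { toMultilinearMap := MultilinearMap.mk'
        (fun a : Fin (n + 2) → A => f.toCMM (Fin.contractNth j.castSucc (· * ·) a))
        (by
          intro a i x y
          obtain ⟨k, L, h⟩ := contractNth_update j i a
          simp only [h, map_add, ContinuousMultilinearMap.map_update_add])
        (by
          intro a i c x
          obtain ⟨k, L, h⟩ := contractNth_update j i a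
          simp only [h, map_smul, ContinuousMultilinearMap.map_update_smul])
      cont := f.toCMM.cont.comp (continuous_contractNth j.castSucc) }

theorem face_apply {n : ℕ} (j : Fin (n + 1)) (f : Cochain A n) (a : Fin (n + 2) → A) :
    face j f a = f (Fin.contractNth j.castSucc (· * ·) a) := rfl

/-- `f(a_{n+1} a₀, a₁, …, aₙ)` as a cochain of degree `n + 1`: the `0`-th face evaluated at
`(a_{n+1}, a₀, …, aₙ)`. -/
def lastFace {n : ℕ} (f : Cochain A n) : Cochain A (n + 1) :=
  Cochain.ofCMM ((face 0 f).toCMM.domDomCongr (Equiv.subRight (1 : Fin (n + 2))))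

theorem lastFace_apply {n : ℕ} (f : Cochain A n) (a : Fin (n + 2) → A) :
    lastFace f a = f (Fin.cons (a (Fin.last (n + 1)) * a 0) fun k : Fin n => a k.succ.castSucc) := by
  change f (Fin.contractNth 0 (· * ·) fun i => a (i - 1)) = _
  congr 1
  funext k
  refine Fin.cases ?_ (fun k => ?_) k
  · have h : (0 : Fin (n + 2)) - 1 = Fin.last (n + 1) := by
      rw [sub_eq_iff_eq_add]; exact (Fin.last_add_one _).symm
    simp [Fin.contractNth, h]
  · have h : k.succ.succ - 1 = k.succ.castSucc := by
      rw [sub_eq_iff_eq_add, Fin.coeSucc_eq_succ]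
    simp [Fin.contractNth, h]

/-- The coboundary operator
`(δ^n f)(a₀, …, a_{n+1}) = ∑_{i=0}^n (-1)^i f(a₀, …, a_i a_{i+1}, …, a_{n+1})
  + (-1)^{n+1} f(a_{n+1} a₀, a₁, …, aₙ)`. -/
def coboundary (n : ℕ) : Cochain A n →ₗ[ℂ] Cochain A (n + 1) where
  toFun f := ∑ i : Fin (n + 1), (-1 : ℂ) ^ (i : ℕ) • face i f + (-1 : ℂ) ^ (n + 1) • lastFace f
  map_add' f g := Cochain.ext fun a => by
    simp only [Cochain.add_apply, Cochain.sum_apply, Cochain.smul_apply, face_apply,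
      lastFace_apply, mul_add, Finset.sum_add_distrib]
    abel
  map_smul' c f := Cochain.ext fun a => by
    simp only [Cochain.add_apply, Cochain.sum_apply, Cochain.smul_apply, face_apply,
      lastFace_apply, mul_add, Finset.mul_sum, RingHom.id_apply, mul_left_comm]

theorem coboundary_apply (n : ℕ) (f : Cochain A n) (a : Fin (n + 2) → A) :
    coboundary n f a =
      ∑ i : Fin (n + 1), (-1 : ℂ) ^ (i : ℕ) * f (Fin.contractNth i.castSucc (· * ·) a) +
        (-1 : ℂ) ^ (n + 1) *
          f (Fin.cons (a (Fin.last (n + 1)) * a 0) fun k : Fin n => a k.succ.castSucc) := by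
  simp only [coboundary, LinearMap.coe_mk, AddHom.coe_mk, Cochain.add_apply, Cochain.sum_apply,
    Cochain.smul_apply, face_apply, lastFace_apply]

variable (A)

/-- The cyclic cocycles `ker (δ^n : CC^n(A) → CC^{n+1}(A))`. -/
def cyclicCocycles (n : ℕ) : Submodule ℂ (Cochain A n) :=
  cyclicCochains A n ⊓ LinearMap.ker (coboundary n)

/-- The cyclic coboundaries `im (δ^{n-1} : CC^{n-1}(A) → CC^n(A))`; there are none but zero
for `n = 0`. -/
def cyclicCoboundaries : (n : ℕ) → Submodule ℂ (Cochain A n)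
  | 0 => ⊥
  | n + 1 => (cyclicCochains A n).map (coboundary n)

/-- The Banach cyclic cohomology group `HC^n(A)`. Its topology is the one of the quotient
seminorm, which comes from the operator norm on bounded multilinear functionals. -/
abbrev HC (n : ℕ) : Type u :=
  ↥(cyclicCocycles A n) ⧸ (cyclicCoboundaries A n).submoduleOf (cyclicCocycles A n)

variable {A}

/-! Functoriality -/

variable {D : Type v} [NonUnitalNormedRing D] [NormedSpace ℂ D]
  [IsScalarTower ℂ D D] [SMulCommClass ℂ D D]

/-- The pullback `(κ^* f)(a₀, …, aₙ) = f(κ a₀, …, κ aₙ)` of cochains. -/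
def pullback (κ : A →L[ℂ] D) (n : ℕ) : Cochain D n →ₗ[ℂ] Cochain A n where
  toFun f := Cochain.ofCMM (f.toCMM.compContinuousLinearMap fun _ => κ)
  map_add' _ _ := rfl
  map_smul' _ _ := rfl

theorem pullback_apply (κ : A →L[ℂ] D) (n : ℕ) (f : Cochain D n) (a : Fin (n + 1) → A) :
    pullback κ n f a = f (fun i => κ (a i)) := rfl

theorem pullback_coboundary (κ : A →L[ℂ] D) (hκ : ∀ a b : A, κ (a * b) = κ a * κ b) (n : ℕ)
    (f : Cochain D n) : pullback κ (n + 1) (coboundary n f) = coboundary n (pullback κ n f) := by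
  refine Cochain.ext fun a => ?_
  simp only [pullback_apply, coboundary_apply]
  congr 1
  · refine Finset.sum_congr rfl fun i _ => ?_
    congr 2
    exact (Fin.comp_contractNth (· * ·) (· * ·) hκ i.castSucc a).symm
  · congr 2
    funext k
    refine Fin.cases ?_ (fun k => ?_) k
    · simp [hκ]
    · simp

theorem pullback_mem_cyclicCochains (κ : A →L[ℂ] D) (n : ℕ) {f : Cochain D n}
    (hf : f ∈ cyclicCochains D n) : pullback κ n f ∈ cyclicCochains A n := by
  rw [mem_cyclicCochains] at hf ⊢
  refine Cochain.ext fun a => ?_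
  have h := congrArg (fun g : Cochain D n => g fun i => κ (a i)) hf
  simpa only [cyclicOp_apply, pullback_apply] using h

theorem pullback_mem_cyclicCocycles (κ : A →L[ℂ] D) (hκ : ∀ a b : A, κ (a * b) = κ a * κ b)
    (n : ℕ) {f : Cochain D n} (hf : f ∈ cyclicCocycles D n) :
    pullback κ n f ∈ cyclicCocycles A n := by
  refine ⟨pullback_mem_cyclicCochains κ n hf.1, ?_⟩
  have h : coboundary n f = 0 := hf.2
  change coboundary n (pullback κ n f) = 0
  rw [← pullback_coboundary κ hκ, h, map_zero]

theorem pullback_mem_cyclicCoboundaries (κ : A →L[ℂ] D) (hκ : ∀ a b : A, κ (a * b) = κ a * κ b) :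
    ∀ (n : ℕ) {f : Cochain D n}, f ∈ cyclicCoboundaries D n →
      pullback κ n f ∈ cyclicCoboundaries A n
  | 0, f, hf => by
    have h : f = 0 := hf
    rw [h, map_zero]
    exact Submodule.zero_mem _
  | n + 1, f, hf => by
    obtain ⟨g, hg, rfl⟩ := hf
    exact ⟨pullback κ n g, pullback_mem_cyclicCochains κ n hg, (pullback_coboundary κ hκ n g).symm⟩

/-- The map `HC^n(D) → HC^n(A)`, `[f] ↦ [f ∘ (κ × ⋯ × κ)]`, induced by a bounded algebra
homomorphism `κ : A → D`. -/
def HC.map (κ : A →L[ℂ] D) (hκ : ∀ a b : A, κ (a * b) = κ a * κ b) (n : ℕ) :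
    HC D n →ₗ[ℂ] HC A n :=
  Submodule.mapQ _ _
    ((pullback κ n).restrict fun _ hf => pullback_mem_cyclicCocycles κ hκ n hf)
    fun _ hf => pullback_mem_cyclicCoboundaries κ hκ n hf

end CochainComplex

/-! ### Closed ideals and quotient algebras -/

section Quotient

/-- A closed two-sided ideal (in particular a linear subspace) of a Banach algebra. -/
structure ClosedIdeal (A : Type u) [NonUnitalNormedRing A] [NormedSpace ℂ A] extends
    NonUnitalSubalgebra ℂ A where
  mul_mem_left : ∀ (a : A) {x : A}, x ∈ carrier → a * x ∈ carrier
  mul_mem_right : ∀ (a : A) {x : A}, x ∈ carrier → x * a ∈ carrier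
  isClosed : IsClosed carrier

variable {A : Type u} [NonUnitalNormedRing A] [NormedSpace ℂ A]

/-- The ideal as a linear subspace. -/
abbrev ClosedIdeal.sub (I : ClosedIdeal A) : Submodule ℂ A := I.toNonUnitalSubalgebra.toSubmodule

instance (I : ClosedIdeal A) : NormedSpace ℂ I.toNonUnitalSubalgebra :=
  inferInstanceAs (NormedSpace ℂ I.sub)

/-- The quotient Banach space `A / I`, with the quotient norm. -/
def ClosedIdeal.Quot (I : ClosedIdeal A) : Type u := A ⧸ I.sub

namespace ClosedIdeal

variable (I : ClosedIdeal A)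

instance instNormedAddCommGroupQuot : NormedAddCommGroup I.Quot :=
  letI : IsClosed (I.sub : Set A) := I.isClosed
  inferInstanceAs (NormedAddCommGroup (A ⧸ I.sub))

instance : NormedSpace ℂ I.Quot :=
  inferInstanceAs (NormedSpace ℂ (A ⧸ I.sub))

instance [CompleteSpace A] : CompleteSpace I.Quot :=
  inferInstanceAs (CompleteSpace (A ⧸ I.sub))

/-- The quotient map `θ : A → A / I`. -/
def quotMap : A →L[ℂ] I.Quot where
  toLinearMap := I.sub.mkQ
  cont := continuous_quot_mk

theorem quotMap_surjective : Function.Surjective I.quotMap := Submodule.mkQ_surjective I.sub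

theorem quotMap_eq {x y : A} : I.quotMap x = I.quotMap y ↔ x - y ∈ I.sub :=
  Submodule.Quotient.eq I.sub

theorem norm_quotMap_le (x : A) : ‖I.quotMap x‖ ≤ ‖x‖ := Submodule.Quotient.norm_mk_le I.sub x

theorem exists_norm_lt (x : I.Quot) {ε : ℝ} (hε : 0 < ε) :
    ∃ a : A, I.quotMap a = x ∧ ‖a‖ < ‖x‖ + ε :=
  Submodule.Quotient.norm_mk_lt (S := I.sub) x hε

instance instMulQuot : Mul I.Quot where
  mul := Quotient.map₂ (· * ·) (by
    intro a a' ha b b' hb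
    have ha' : a - a' ∈ I.sub := (I.quotMap_eq).1 (Quotient.sound ha)
    have hb' : b - b' ∈ I.sub := (I.quotMap_eq).1 (Quotient.sound hb)
    refine Quotient.exact ((I.quotMap_eq).2 ?_)
    have h : a * b - a' * b' = (a - a') * b + a' * (b - b') := by noncomm_ring
    rw [h]
    exact I.sub.add_mem (I.mul_mem_right b ha') (I.mul_mem_left a' hb'))

/-- The quotient map is multiplicative; this describes the product of `A / I`. -/
theorem quotMap_mul (a b : A) : I.quotMap (a * b) = I.quotMap a * I.quotMap b := rfl

instance : NonUnitalNormedRing I.Quot :=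
  { I.instNormedAddCommGroupQuot, I.instMulQuot with
    left_distrib := fun x y z => by
      obtain ⟨x, rfl⟩ := I.quotMap_surjective x
      obtain ⟨y, rfl⟩ := I.quotMap_surjective y
      obtain ⟨z, rfl⟩ := I.quotMap_surjective z
      change I.quotMap x * (I.quotMap y + I.quotMap z) =
        I.quotMap x * I.quotMap y + I.quotMap x * I.quotMap z
      simp only [← map_add, ← quotMap_mul, mul_add]
    right_distrib := fun x y z => by
      obtain ⟨x, rfl⟩ := I.quotMap_surjective x
      obtain ⟨y, rfl⟩ := I.quotMap_surjective y
      obtain ⟨z, rfl⟩ := I.quotMap_surjective z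
      change (I.quotMap x + I.quotMap y) * I.quotMap z =
        I.quotMap x * I.quotMap z + I.quotMap y * I.quotMap z
      simp only [← map_add, ← quotMap_mul, add_mul]
    zero_mul := fun x => by
      obtain ⟨x, rfl⟩ := I.quotMap_surjective x
      change 0 * I.quotMap x = 0
      rw [← map_zero I.quotMap, ← quotMap_mul, zero_mul]
    mul_zero := fun x => by
      obtain ⟨x, rfl⟩ := I.quotMap_surjective x
      change I.quotMap x * 0 = 0
      rw [← map_zero I.quotMap, ← quotMap_mul, mul_zero]
    mul_assoc := fun x y z => by
      obtain ⟨x, rfl⟩ := I.quotMap_surjective x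
      obtain ⟨y, rfl⟩ := I.quotMap_surjective y
      obtain ⟨z, rfl⟩ := I.quotMap_surjective z
      change I.quotMap x * I.quotMap y * I.quotMap z = I.quotMap x * (I.quotMap y * I.quotMap z)
      simp only [← quotMap_mul, mul_assoc]
    norm_mul_le := fun x y => by
      change ‖x * y‖ ≤ ‖x‖ * ‖y‖
      have key : ∀ ε : ℝ, 0 < ε → ‖x * y‖ ≤ (‖x‖ + ε) * (‖y‖ + ε) := by
        intro ε hε
        obtain ⟨a, rfl, ha⟩ := I.exists_norm_lt x hε
        obtain ⟨b, rfl, hb⟩ := I.exists_norm_lt y hε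
        rw [← quotMap_mul]
        exact (I.norm_quotMap_le _).trans ((norm_mul_le a b).trans
          (mul_le_mul ha.le hb.le (norm_nonneg _) (by positivity)))
      have hlim : Tendsto (fun ε : ℝ => (‖x‖ + ε) * (‖y‖ + ε)) (𝓝[>] 0) (𝓝 (‖x‖ * ‖y‖)) := by
        have hc : Continuous fun ε : ℝ => (‖x‖ + ε) * (‖y‖ + ε) := by fun_prop
        simpa using (hc.tendsto 0).mono_left nhdsWithin_le_nhds
      exact ge_of_tendsto hlim (eventually_mem_nhdsWithin.mono fun ε hε => key ε hε) }

instance [IsScalarTower ℂ A A] : IsScalarTower ℂ I.Quot I.Quot where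
  smul_assoc c x y := by
    obtain ⟨x, rfl⟩ := I.quotMap_surjective x
    obtain ⟨y, rfl⟩ := I.quotMap_surjective y
    change (c • I.quotMap x) * I.quotMap y = c • (I.quotMap x * I.quotMap y)
    simp only [← map_smul, ← quotMap_mul, smul_mul_assoc]

instance [SMulCommClass ℂ A A] : SMulCommClass ℂ I.Quot I.Quot where
  smul_comm c x y := by
    obtain ⟨x, rfl⟩ := I.quotMap_surjective x
    obtain ⟨y, rfl⟩ := I.quotMap_surjective y
    change c • (I.quotMap x * I.quotMap y) = I.quotMap x * (c • I.quotMap y)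
    simp only [← map_smul, ← quotMap_mul, mul_smul_comm]

variable [IsScalarTower ℂ A A] [SMulCommClass ℂ A A]

/-- The natural map `HC^n(A / I) → HC^n(A)` induced by the quotient map. -/
def naturalMap (n : ℕ) : HC I.Quot n →ₗ[ℂ] HC A n := HC.map I.quotMap I.quotMap_mul n

end ClosedIdeal

end Quotient

end BanachCyclic

end

namespace BanachCyclic

noncomputable section

universe u v

/-! ### Operations on sequences of arguments -/

section Sequences

variable {A : Type u} [Semigroup A]

/-! Cochains on `A` that vanish as soon as one argument lies in `I` are exactly the pullbacks of
cochains on `A / I`. So the natural map comes from the inclusion of a subcomplex, and by the long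
exact sequence everything reduces to the cyclic complex of `A` modulo cyclic cochains vanishing on
`I`. Exactness of this relative complex in degree `n` (`IsRelativelyExact`) gives surjectivity in
degree `n` and injectivity in degree `n + 1`.

Relative exactness propagates from `n` to `n + 2` (`IsRelativelyExact.add_two`). This is the
periodicity argument of the Connes–Tsygan bicomplex, with columns the Hochschild complex and the bar
complex, linked by `1 - s` and the norm `N = 1 + s + ⋯ + sⁿ`, where `s` is the signed rotation. It
needs two inputs. The relative bar complex is exact in positive degrees because the approximate
identity of `A` yields a contracting homotopy (`exists_sub_barCoboundary_mem_vanishing`). The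
relative Hochschild complex is exact in positive degrees because `I` is amenable
(`exists_sub_coboundary_mem_vanishing`): a cochain is corrected until it vanishes on `I` in its
first two slots, through an inner derivation, and then in one further slot at a time, by averaging
against a left identity of the bidual of `I`.

Degree `1` is relatively exact since all `0`-cochains are cyclic, so all odd degrees are. Degree `0`
is relatively exact when `I` has no nonzero bounded trace, and then so are all degrees. The inverse
of a bijective natural map is continuous by the open mapping theorem, applied to cocycles before
passing to the possibly non-Hausdorff quotients. -/

/-- The sequence with the entries `j` and `j + 1` replaced by their product. -/
def mergeAt (j : ℕ) (a : ℕ → A) : ℕ → A := fun i =>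
  if i < j then a i else if i = j then a j * a (j + 1) else a (i + 1)

/-- The sequence with `c` inserted at position `p`. -/
def insertAt (p : ℕ) (c : A) (a : ℕ → A) : ℕ → A := fun i =>
  if i < p then a i else if i = p then c else a (i - 1)

/-- The rotation `(a₀, …, aₙ) ↦ (aₙ, a₀, …, aₙ₋₁)`. -/
def rotateSeq (n : ℕ) (a : ℕ → A) : ℕ → A := fun i => if i = 0 then a n else a (i - 1)

/-- This and the next four identities are the relations of a cyclic object, on infinite sequences.
Two of them are restricted to `k ≤ n`, since entries beyond the degree of the cochain are
meaningless after a rotation. -/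
theorem mergeAt_mergeAt {i j : ℕ} (h : i ≤ j) (a : ℕ → A) :
    mergeAt i (mergeAt (j + 1) a) = mergeAt j (mergeAt i a) := by
  funext k
  rcases lt_trichotomy k i with hk | rfl | hk <;> grind [mergeAt, mul_assoc]

theorem mergeAt_mergeAt_rotateSeq {i n : ℕ} (h : i ≤ n) (a : ℕ → A) :
    mergeAt i (mergeAt 0 (rotateSeq (n + 2) a)) = mergeAt 0 (rotateSeq (n + 1) (mergeAt i a)) := by
  funext k
  grind [mergeAt, rotateSeq, mul_assoc]

theorem mergeAt_rotateSeq_mergeAt_rotateSeq {n k : ℕ} (hk : k ≤ n) (a : ℕ → A) :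
    mergeAt 0 (rotateSeq (n + 1) (mergeAt 0 (rotateSeq (n + 2) a))) k =
      mergeAt 0 (rotateSeq (n + 1) (mergeAt (n + 1) a)) k := by
  grind [mergeAt, rotateSeq, mul_assoc]

theorem mergeAt_succ_rotateSeq {n j : ℕ} (hj : j < n) (k : ℕ) (a : ℕ → A) :
    mergeAt (j + 1) (rotateSeq (n + 1) a) k = rotateSeq n (mergeAt j a) k := by
  grind [mergeAt, rotateSeq]

theorem mergeAt_rotateSeq_rotateSeq {n k : ℕ} (hk : k ≤ n) (a : ℕ → A) :
    mergeAt 0 (rotateSeq (n + 1) (rotateSeq (n + 1) a)) k = rotateSeq n (mergeAt n a) k := by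
  grind [mergeAt, rotateSeq]

end Sequences

/-! ### Rotation, norm and coface operators, and the identities of the cyclic bicomplex. -/

section Operators

variable {A : Type u} [NonUnitalNormedRing A] [NormedSpace ℂ A]

/-- The value of a cochain at the initial part of a sequence. -/
def Cochain.seq {n : ℕ} (f : Cochain A n) (a : ℕ → A) : ℂ := f fun i : Fin (n + 1) => a i

namespace Cochain

variable {n : ℕ}

theorem seq_congr (f : Cochain A n) {a b : ℕ → A} (h : ∀ i ≤ n, a i = b i) : f.seq a = f.seq b := by
  unfold seq
  congr 1
  funext i
  exact h i (Nat.lt_succ_iff.mp i.2)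

omit [NormedSpace ℂ A] in
theorem exists_seq (a : Fin (n + 1) → A) : ∃ b : ℕ → A, (fun i : Fin (n + 1) => b i) = a :=
  ⟨fun i => if h : i < n + 1 then a ⟨i, h⟩ else 0, funext fun i => dif_pos i.2⟩

theorem ext_seq {f g : Cochain A n} (h : ∀ a : ℕ → A, f.seq a = g.seq a) : f = g :=
  Cochain.ext fun a => by
    obtain ⟨b, rfl⟩ := exists_seq a
    exact h b

theorem add_seq (f g : Cochain A n) (a : ℕ → A) : (f + g).seq a = f.seq a + g.seq a := rfl

theorem sub_seq (f g : Cochain A n) (a : ℕ → A) : (f - g).seq a = f.seq a - g.seq a := rfl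

theorem neg_seq (f : Cochain A n) (a : ℕ → A) : (-f).seq a = -f.seq a := rfl

theorem zero_seq (a : ℕ → A) : (0 : Cochain A n).seq a = 0 := rfl

theorem smul_seq (c : ℂ) (f : Cochain A n) (a : ℕ → A) : (c • f).seq a = c * f.seq a := rfl

theorem sum_seq {ι : Type*} (s : Finset ι) (f : ι → Cochain A n) (a : ℕ → A) :
    (∑ i ∈ s, f i).seq a = ∑ i ∈ s, (f i).seq a := Cochain.sum_apply s f _

end Cochain

/-- The inverse of the cyclic operator: `(s f)(a₀, …, aₙ) = (-1)^n f(aₙ, a₀, …, aₙ₋₁)`. -/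
def rotOp (n : ℕ) : Cochain A n →ₗ[ℂ] Cochain A n where
  toFun f := (-1 : ℂ) ^ n •
    Cochain.ofCMM (f.toCMM.domDomCongr (Equiv.subRight (1 : Fin (n + 1))))
  map_add' _ _ := Cochain.ext fun _ => mul_add _ _ _
  map_smul' _ _ := Cochain.ext fun _ => mul_left_comm _ _ _

theorem rotOp_apply (n : ℕ) (f : Cochain A n) (a : Fin (n + 1) → A) :
    rotOp n f a = (-1 : ℂ) ^ n * f (fun i => a (i - 1)) := rfl

theorem rotOp_seq (n : ℕ) (f : Cochain A n) (a : ℕ → A) :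
    (rotOp n f).seq a = (-1 : ℂ) ^ n * f.seq (rotateSeq n a) := by
  unfold Cochain.seq
  rw [rotOp_apply]
  congr 2
  funext i
  refine Fin.cases ?_ (fun k => ?_) i
  · have h : (0 : Fin (n + 1)) - 1 = Fin.last n := by
      rw [sub_eq_iff_eq_add]; exact (Fin.last_add_one _).symm
    simp [rotateSeq, h]
  · cases n with
    | zero => exact k.elim0
    | succ n =>
      have h : k.succ - 1 = k.castSucc := by
        rw [sub_eq_iff_eq_add, Fin.coeSucc_eq_succ]
      simp [rotateSeq, h]

theorem rotOp_pow_apply (n k : ℕ) (f : Cochain A n) (a : Fin (n + 1) → A) :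
    ((rotOp n ^ k) f) a = ((-1 : ℂ) ^ n) ^ k * f (fun i => a (i - k • (1 : Fin (n + 1)))) := by
  induction k generalizing a with
  | zero => simp
  | succ k ih =>
    rw [pow_succ', Module.End.mul_apply, rotOp_apply, ih, pow_succ', mul_assoc]
    congr 3
    funext i
    congr 1
    rw [succ_nsmul]
    abel

/-- The accumulated sign is `(-1) ^ (n (n + 1))`, and `n (n + 1)` is even. -/
theorem rotOp_pow_card (n : ℕ) : (rotOp n ^ (n + 1) : Module.End ℂ (Cochain A n)) = 1 := by
  have h : (n + 1) • (1 : Fin (n + 1)) = 0 := by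
    simpa using card_nsmul_eq_zero' (x := (1 : Fin (n + 1)))
  refine LinearMap.ext fun f => Cochain.ext fun a => ?_
  rw [rotOp_pow_apply, ← pow_mul, (Nat.even_mul_succ_self n).neg_one_pow, h]
  simp

theorem cyclicOp_rotOp (n : ℕ) (f : Cochain A n) : cyclicOp n (rotOp n f) = f := by
  refine Cochain.ext fun a => ?_
  rw [cyclicOp_apply, rotOp_apply, ← mul_assoc, ← mul_pow]
  simp

theorem rotOp_cyclicOp (n : ℕ) (f : Cochain A n) : rotOp n (cyclicOp n f) = f := by
  refine Cochain.ext fun a => ?_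
  rw [rotOp_apply, cyclicOp_apply, ← mul_assoc, ← mul_pow]
  simp

theorem mem_cyclicCochains_iff_rotOp {n : ℕ} {f : Cochain A n} :
    f ∈ cyclicCochains A n ↔ rotOp n f = f := by
  rw [mem_cyclicCochains]
  constructor
  · intro h
    conv_lhs => rw [← h]
    exact rotOp_cyclicOp n f
  · intro h
    conv_lhs => rw [← h]
    exact cyclicOp_rotOp n f

/-- The norm operator `1 + s + ⋯ + sⁿ`. -/
def normOp (n : ℕ) : Module.End ℂ (Cochain A n) := ∑ k ∈ Finset.range (n + 1), rotOp n ^ k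

theorem normOp_mul_rotOp (n : ℕ) : (normOp n * rotOp n : Module.End ℂ (Cochain A n)) = normOp n := by
  have h : (normOp n * rotOp n : Module.End ℂ (Cochain A n)) =
      ∑ k ∈ Finset.range (n + 1), rotOp n ^ (k + 1) := by
    simp only [normOp, Finset.sum_mul, pow_succ]
  rw [h, normOp, Finset.sum_range_succ, rotOp_pow_card, Finset.sum_range_succ', pow_zero]

theorem rotOp_mul_normOp (n : ℕ) : (rotOp n * normOp n : Module.End ℂ (Cochain A n)) = normOp n := by
  have h : (rotOp n * normOp n : Module.End ℂ (Cochain A n)) = normOp n * rotOp n := by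
    simp only [normOp, Finset.sum_mul, Finset.mul_sum, ← pow_succ, ← pow_succ']
  rw [h, normOp_mul_rotOp]

theorem normOp_rotOp (n : ℕ) (f : Cochain A n) : normOp n (rotOp n f) = normOp n f :=
  LinearMap.congr_fun (normOp_mul_rotOp n) f

theorem rotOp_normOp (n : ℕ) (f : Cochain A n) : rotOp n (normOp n f) = normOp n f :=
  LinearMap.congr_fun (rotOp_mul_normOp n) f

theorem normOp_mem_cyclicCochains (n : ℕ) (f : Cochain A n) : normOp n f ∈ cyclicCochains A n :=
  mem_cyclicCochains_iff_rotOp.2 (rotOp_normOp n f)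

theorem normOp_of_cyclic {n : ℕ} {f : Cochain A n} (hf : f ∈ cyclicCochains A n) :
    normOp n f = ((n : ℂ) + 1) • f := by
  rw [mem_cyclicCochains_iff_rotOp] at hf
  have h : ∀ k, (rotOp n ^ k) f = f := by
    intro k
    induction k with
    | zero => rfl
    | succ k ih => rw [pow_succ, Module.End.mul_apply, hf, ih]
  simp only [normOp, LinearMap.sum_apply, h, Finset.sum_const, Finset.card_range]
  rw [← Nat.cast_smul_eq_nsmul ℂ]
  simp

/-- An operator `q` with `(n + 1) - N = q (1 - s)`. -/
def normHomotopy (n : ℕ) : Module.End ℂ (Cochain A n) :=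
  ∑ k ∈ Finset.range (n + 1), ∑ j ∈ Finset.range k, rotOp n ^ j

theorem one_sub_rotOp_mul_normHomotopy (n : ℕ) :
    ((1 - rotOp n) * normHomotopy n : Module.End ℂ (Cochain A n)) =
      ((n : ℂ) + 1) • 1 - normOp n := by
  have h : ∀ k, ((1 - rotOp n) * ∑ j ∈ Finset.range k, rotOp n ^ j : Module.End ℂ (Cochain A n)) =
      1 - rotOp n ^ k := fun k => mul_neg_geom_sum _ _
  simp only [normHomotopy, Finset.mul_sum (Finset.range (n + 1)), h, Finset.sum_sub_distrib,
    Finset.sum_const, Finset.card_range, normOp]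
  rw [← Nat.cast_smul_eq_nsmul ℂ]
  simp

theorem normHomotopy_mul_one_sub_rotOp (n : ℕ) :
    (normHomotopy n * (1 - rotOp n) : Module.End ℂ (Cochain A n)) =
      ((n : ℂ) + 1) • 1 - normOp n := by
  have h : ∀ k, ((∑ j ∈ Finset.range k, rotOp n ^ j) * (1 - rotOp n) : Module.End ℂ (Cochain A n)) =
      1 - rotOp n ^ k := fun k => geom_sum_mul_neg _ _
  simp only [normHomotopy, Finset.sum_mul (Finset.range (n + 1)), h, Finset.sum_sub_distrib,
    Finset.sum_const, Finset.card_range, normOp]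
  rw [← Nat.cast_smul_eq_nsmul ℂ]
  simp

variable [IsScalarTower ℂ A A] [SMulCommClass ℂ A A]

/-- The signed cofaces `C^n(A) → C^{n+1}(A)`; `j = n + 1` gives the cyclic one. -/
def coface (n j : ℕ) : Cochain A n →ₗ[ℂ] Cochain A (n + 1) where
  toFun f := if h : j < n + 1 then (-1 : ℂ) ^ j • face ⟨j, h⟩ f else (-1 : ℂ) ^ (n + 1) • lastFace f
  map_add' f g := by
    refine Cochain.ext fun a => ?_
    split_ifs <;>
      simp only [Cochain.smul_apply, Cochain.add_apply, face_apply, lastFace_apply, mul_add]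
  map_smul' c f := by
    refine Cochain.ext fun a => ?_
    split_ifs <;>
      simp only [Cochain.smul_apply, face_apply, lastFace_apply, RingHom.id_apply, mul_left_comm]

theorem coface_seq {n j : ℕ} (h : j ≤ n) (f : Cochain A n) (a : ℕ → A) :
    (coface n j f).seq a = (-1 : ℂ) ^ j * f.seq (mergeAt j a) := by
  have h' : j < n + 1 := Nat.lt_succ_iff.mpr h
  simp only [coface, LinearMap.coe_mk, AddHom.coe_mk, h', dite_true, Cochain.smul_seq]
  congr 1
  unfold Cochain.seq
  rw [face_apply]
  congr 1
  funext i
  simp only [Fin.contractNth, mergeAt, Fin.val_castSucc, Fin.val_succ]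
  split_ifs <;> simp_all

theorem coface_last_seq (n : ℕ) (f : Cochain A n) (a : ℕ → A) :
    (coface n (n + 1) f).seq a =
      (-1 : ℂ) ^ (n + 1) * f.seq (mergeAt 0 (rotateSeq (n + 1) a)) := by
  simp only [coface, LinearMap.coe_mk, AddHom.coe_mk, lt_irrefl, dite_false, Cochain.smul_seq]
  congr 1
  unfold Cochain.seq
  rw [lastFace_apply]
  congr 1
  funext i
  refine Fin.cases ?_ (fun k => ?_) i
  · simp [mergeAt, rotateSeq]
  · simp [mergeAt, rotateSeq]

theorem coboundary_eq_sum (n : ℕ) :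
    coboundary (A := A) n = ∑ j ∈ Finset.range (n + 2), coface n j := by
  refine LinearMap.ext fun f => ?_
  rw [LinearMap.sum_apply, Finset.sum_range_succ]
  change ∑ i : Fin (n + 1), (-1 : ℂ) ^ (i : ℕ) • face i f + (-1 : ℂ) ^ (n + 1) • lastFace f = _
  congr 1
  · rw [Finset.sum_range]
    refine Finset.sum_congr rfl fun i _ => ?_
    simp only [coface, LinearMap.coe_mk, AddHom.coe_mk, dif_pos i.2]
  · simp [coface]

/-- The coboundary without its cyclic term. -/
def barCoboundary (n : ℕ) : Cochain A n →ₗ[ℂ] Cochain A (n + 1) :=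
  ∑ j ∈ Finset.range (n + 1), coface n j

/-- The coboundary without its zeroth term. -/
def tailCoboundary (n : ℕ) : Cochain A n →ₗ[ℂ] Cochain A (n + 1) :=
  ∑ j ∈ Finset.range (n + 1), coface n (j + 1)

theorem coboundary_eq_bar (n : ℕ) :
    coboundary (A := A) n = barCoboundary n + coface n (n + 1) := by
  rw [coboundary_eq_sum, Finset.sum_range_succ, barCoboundary]

theorem coboundary_eq_tail (n : ℕ) :
    coboundary (A := A) n = tailCoboundary n + coface n 0 := by
  rw [coboundary_eq_sum, Finset.sum_range_succ', tailCoboundary]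

theorem rotOp_coface_zero (n : ℕ) (f : Cochain A n) :
    rotOp (n + 1) (coface n 0 f) = coface n (n + 1) f := by
  refine Cochain.ext_seq fun a => ?_
  rw [rotOp_seq, coface_seq (Nat.zero_le _), coface_last_seq, pow_zero, one_mul]

/-- Rotation shifts the index of a coface down by one; together with `rotOp_coface_zero` this gives
every identity between `rotOp` and the coboundaries. The signs built into both operators absorb all
others. -/
theorem rotOp_coface_succ {n j : ℕ} (hj : j ≤ n) (f : Cochain A n) :
    rotOp (n + 1) (coface n (j + 1) f) = coface n j (rotOp n f) := by
  refine Cochain.ext_seq fun a => ?_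
  rw [rotOp_seq, coface_seq hj, rotOp_seq]
  rcases hj.lt_or_eq with hj | rfl
  · rw [coface_seq hj, f.seq_congr fun k _ => mergeAt_succ_rotateSeq hj k a, pow_succ _ j]
    ring
  · rw [coface_last_seq, f.seq_congr fun k hk => mergeAt_rotateSeq_rotateSeq hk a]
    ring

theorem coface_coface {n i j : ℕ} (hij : i < j) (hj : j ≤ n + 2) (f : Cochain A n) :
    coface (n + 1) j (coface n i f) = -coface (n + 1) i (coface n (j - 1) f) := by
  obtain ⟨j, rfl⟩ : ∃ k, j = k + 1 := ⟨j - 1, by omega⟩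
  rw [Nat.add_sub_cancel]
  refine Cochain.ext_seq fun a => ?_
  rw [Cochain.neg_seq]
  rcases hj.lt_or_eq with hj | hj
  · rw [coface_seq (by omega), coface_seq (by omega), coface_seq (by omega),
      coface_seq (by omega), mergeAt_mergeAt (by omega)]
    ring
  · obtain rfl : j = n + 1 := by omega
    have h1 := coface_seq (show i ≤ n + 1 by omega) (coface n (n + 1) f) a
    rw [h1, coface_last_seq, coface_last_seq]
    rcases (show i ≤ n + 1 by omega).lt_or_eq with hi | rfl
    · rw [coface_seq (by omega), mergeAt_mergeAt_rotateSeq (by omega)]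
      ring
    · rw [coface_last_seq, f.seq_congr fun k hk => mergeAt_rotateSeq_mergeAt_rotateSeq hk a]
      ring

/-- The term at `(j, i)` with `i < j` cancels the one at `(i, j - 1)`. Stated abstractly, it shows
that the full, the bar and the tail coboundary all square to zero. -/
theorem sum_sum_eq_zero_of_antisymm {M : Type*} [AddCommGroup M] (a : ℕ → ℕ → M) (m : ℕ)
    (h : ∀ i j, i < j → j ≤ m → a j i = -a i (j - 1)) :
    ∑ j ∈ Finset.range (m + 1), ∑ i ∈ Finset.range m, a j i = 0 := by
  induction m with
  | zero => simp
  | succ m ih =>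
    have h1 : ∀ i ∈ Finset.range (m + 1), a (m + 1) i = -a i m := fun i hi => by
      rw [h i (m + 1) (Finset.mem_range.1 hi) le_rfl, Nat.add_sub_cancel]
    have h2 : ∀ j, ∑ i ∈ Finset.range (m + 1), a j i = ∑ i ∈ Finset.range m, a j i + a j m :=
      fun j => Finset.sum_range_succ _ m
    rw [Finset.sum_range_succ, Finset.sum_congr rfl h1, Finset.sum_neg_distrib,
      Finset.sum_congr rfl fun j _ => h2 j, Finset.sum_add_distrib,
      ih fun i j hij hj => h i j hij (by omega), zero_add, add_neg_cancel]

theorem coboundary_coboundary (n : ℕ) (f : Cochain A n) :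
    coboundary (n + 1) (coboundary n f) = 0 := by
  rw [coboundary_eq_sum, coboundary_eq_sum, LinearMap.sum_apply]
  simp_rw [LinearMap.sum_apply, map_sum]
  exact sum_sum_eq_zero_of_antisymm (fun j i => coface (n + 1) j (coface n i f)) (n + 2)
    fun i j hij hj => coface_coface hij hj f

theorem barCoboundary_barCoboundary (n : ℕ) (f : Cochain A n) :
    barCoboundary (n + 1) (barCoboundary n f) = 0 := by
  rw [barCoboundary, barCoboundary, LinearMap.sum_apply]
  simp_rw [LinearMap.sum_apply, map_sum]
  exact sum_sum_eq_zero_of_antisymm (fun j i => coface (n + 1) j (coface n i f)) (n + 1)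
    fun i j hij hj => coface_coface hij (by omega) f

theorem tailCoboundary_tailCoboundary (n : ℕ) (f : Cochain A n) :
    tailCoboundary (n + 1) (tailCoboundary n f) = 0 := by
  rw [tailCoboundary, tailCoboundary, LinearMap.sum_apply]
  simp_rw [LinearMap.sum_apply, map_sum]
  refine sum_sum_eq_zero_of_antisymm (fun j i => coface (n + 1) (j + 1) (coface n (i + 1) f))
    (n + 1) fun i j hij hj => ?_
  obtain ⟨j, rfl⟩ : ∃ k, j = k + 1 := ⟨j - 1, by omega⟩
  exact coface_coface (by omega) (by omega) f

/-- The first square of the bicomplex, `(1 - s) δ = b' (1 - s)`: rotating `δ f` sends the zeroth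
coface to the cyclic one and shifts the others down onto `b' (s f)`. -/
theorem coboundary_sub_rotOp (n : ℕ) (f : Cochain A n) :
    coboundary n f - rotOp (n + 1) (coboundary n f) = barCoboundary n (f - rotOp n f) := by
  have h : rotOp (n + 1) (coboundary n f) = coface n (n + 1) f + barCoboundary n (rotOp n f) := by
    rw [coboundary_eq_tail, LinearMap.add_apply, map_add, rotOp_coface_zero, add_comm (rotOp (n + 1) _),
      tailCoboundary, barCoboundary, LinearMap.sum_apply, LinearMap.sum_apply, map_sum]
    congr 1
    exact Finset.sum_congr rfl fun j hj =>
      rotOp_coface_succ (Nat.lt_succ_iff.1 (Finset.mem_range.1 hj)) f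
  rw [h, coboundary_eq_bar, LinearMap.add_apply, map_sub]
  abel

/-- Since `N = N s`, each rotation under `N` lowers the index by one and moves a factor `s` onto
`f`. -/
theorem normOp_coface {n j : ℕ} (hj : j ≤ n + 1) (f : Cochain A n) :
    normOp (n + 1) (coface n j f) = normOp (n + 1) (coface n 0 ((rotOp n ^ j) f)) := by
  induction j generalizing f with
  | zero => rfl
  | succ j ih =>
    rw [← normOp_rotOp, rotOp_coface_succ (by omega), ih (by omega), ← Module.End.mul_apply,
      ← pow_succ]

theorem normOp_barCoboundary (n : ℕ) (f : Cochain A n) :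
    normOp (n + 1) (barCoboundary n f) = normOp (n + 1) (coface n 0 (normOp n f)) := by
  conv_rhs => rw [normOp.eq_def n]
  simp only [barCoboundary, LinearMap.sum_apply, map_sum]
  exact Finset.sum_congr rfl fun j hj => normOp_coface (by have := Finset.mem_range.1 hj; omega) f

theorem rotOp_pow_coface (n k : ℕ) (hk : k ≤ n + 1) {f : Cochain A n}
    (hf : f ∈ cyclicCochains A n) :
    (rotOp (n + 1) ^ (k + 1)) (coface n 0 f) = coface n (n + 1 - k) f := by
  induction k with
  | zero => exact rotOp_coface_zero n f
  | succ k ih =>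
    rw [pow_succ', Module.End.mul_apply, ih (by omega),
      show n + 1 - k = n + 1 - (k + 1) + 1 by omega, rotOp_coface_succ (by omega),
      mem_cyclicCochains_iff_rotOp.1 hf]

/-- For cyclic `f` the `n + 2` powers of the rotation carry the zeroth coface through all the
cofaces in turn. -/
theorem coboundary_of_cyclic (n : ℕ) {f : Cochain A n} (hf : f ∈ cyclicCochains A n) :
    coboundary n f = normOp (n + 1) (coface n 0 f) := by
  rw [coboundary_eq_sum, ← normOp_rotOp, normOp, LinearMap.sum_apply, LinearMap.sum_apply,
    ← Finset.sum_range_reflect]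
  refine Finset.sum_congr rfl fun k hk => ?_
  have hk' := Finset.mem_range.1 hk
  rw [← Module.End.mul_apply, ← pow_succ, rotOp_pow_coface n k (by omega) hf]
  congr 2

/-- The second square of the bicomplex, `δ N = N b'`. -/
theorem coboundary_normOp (n : ℕ) (f : Cochain A n) :
    coboundary n (normOp n f) = normOp (n + 1) (barCoboundary n f) := by
  rw [normOp_barCoboundary, coboundary_of_cyclic n (normOp_mem_cyclicCochains n f)]

theorem coboundary_mem_cyclicCochains {n : ℕ} {f : Cochain A n} (hf : f ∈ cyclicCochains A n) :
    coboundary n f ∈ cyclicCochains A (n + 1) := by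
  rw [coboundary_of_cyclic n hf]
  exact normOp_mem_cyclicCochains _ _

end Operators

/-! ### Continuity -/

section Continuity

variable {A : Type u} [NonUnitalNormedRing A] [NormedSpace ℂ A]
variable {D : Type v} [NonUnitalNormedRing D] [NormedSpace ℂ D]

instance (n : ℕ) : CompleteSpace (Cochain A n) :=
  inferInstanceAs (CompleteSpace (ContinuousMultilinearMap ℂ (fun _ : Fin (n + 1) => A) ℂ))

/-- Evaluation at the initial part of a sequence, as a bounded functional. -/
def Cochain.evalCLM (n : ℕ) (a : ℕ → A) : Cochain A n →L[ℂ] ℂ :=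
  ContinuousMultilinearMap.apply ℂ (fun _ : Fin (n + 1) => A) ℂ fun i => a i

/-- Linear maps between spaces of cochains that are pointwise continuous are continuous. -/
theorem continuous_of_continuous_seq {m n : ℕ} (T : Cochain A m →ₗ[ℂ] Cochain D n)
    (h : ∀ a : ℕ → D, Continuous fun f => (T f).seq a) : Continuous T := by
  -- Closed graph theorem: norm limits of cochains are pointwise limits, so pointwise continuity
  -- closes the graph.
  refine T.continuous_of_seq_closed_graph fun x f g hx hg => Cochain.ext_seq fun a => ?_
  have h1 := ((Cochain.evalCLM n a).continuous.tendsto g).comp hg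
  have h2 := ((h a).tendsto f).comp hx
  exact tendsto_nhds_unique h1 h2

theorem continuous_cyclicOp (n : ℕ) : Continuous (cyclicOp (A := A) n) := by
  refine continuous_of_continuous_seq _ fun a => ?_
  exact continuous_const.mul
    (ContinuousMultilinearMap.apply ℂ (fun _ : Fin (n + 1) => A) ℂ _).continuous

theorem continuous_pullback (κ : A →L[ℂ] D) (n : ℕ) : Continuous (pullback κ n) := by
  refine continuous_of_continuous_seq _ fun a => ?_
  exact (ContinuousMultilinearMap.apply ℂ (fun _ : Fin (n + 1) => D) ℂ _).continuous

variable [IsScalarTower ℂ A A] [SMulCommClass ℂ A A]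

theorem continuous_coface {n j : ℕ} (hj : j ≤ n + 1) : Continuous (coface (A := A) n j) := by
  refine continuous_of_continuous_seq _ fun a => ?_
  rcases hj.lt_or_eq with hj | rfl
  · simp only [coface_seq (Nat.lt_succ_iff.1 hj)]
    exact continuous_const.mul (Cochain.evalCLM n _).continuous
  · simp only [coface_last_seq]
    exact continuous_const.mul (Cochain.evalCLM n _).continuous

theorem continuous_coboundary (n : ℕ) : Continuous (coboundary (A := A) n) := by
  have h : ⇑(coboundary (A := A) n) = fun f => ∑ j ∈ Finset.range (n + 2), coface n j f := by
    funext f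
    rw [coboundary_eq_sum, LinearMap.sum_apply]
  rw [h]
  exact continuous_finsetSum _ fun j hj =>
    continuous_coface (by have := Finset.mem_range.1 hj; omega)

theorem continuous_tailCoboundary (n : ℕ) : Continuous (tailCoboundary (A := A) n) := by
  have h : ⇑(tailCoboundary (A := A) n) =
      fun f => ∑ j ∈ Finset.range (n + 1), coface n (j + 1) f := by
    funext f
    rw [tailCoboundary, LinearMap.sum_apply]
  rw [h]
  exact continuous_finsetSum _ fun j hj =>
    continuous_coface (by have := Finset.mem_range.1 hj; omega)

end Continuity

/-! ### Insertion of an argument -/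

section Insertion

variable {A : Type u} [NonUnitalNormedRing A]

theorem mergeAt_insertAt_of_lt {p j : ℕ} (h : p ≤ j) (c : A) (a : ℕ → A) :
    mergeAt (j + 1) (insertAt p c a) = insertAt p c (mergeAt j a) := by
  funext k
  grind [mergeAt, insertAt]

theorem mergeAt_insertAt_of_gt {p j : ℕ} (h : j < p) (c : A) (a : ℕ → A) :
    mergeAt j (insertAt (p + 1) c a) = insertAt p c (mergeAt j a) := by
  funext k
  grind [mergeAt, insertAt]

theorem mergeAt_insertAt_insertAt (p : ℕ) (c d : A) (a : ℕ → A) :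
    mergeAt p (insertAt p c (insertAt p d a)) = insertAt p (c * d) a := by
  funext k
  grind [mergeAt, insertAt]

theorem mergeAt_rotateSeq_insertAt {n p : ℕ} (hp : 1 ≤ p) (hn : p ≤ n + 1) (c : A) (a : ℕ → A) :
    mergeAt 0 (rotateSeq (n + 2) (insertAt p c a)) =
      insertAt p c (mergeAt 0 (rotateSeq (n + 1) a)) := by
  funext k
  grind [mergeAt, insertAt, rotateSeq]

variable [NormedSpace ℂ A] {n : ℕ}

/-- Insertion of `c` at position `p`. -/
def ins (p : Fin (n + 2)) : Cochain A (n + 1) →L[ℂ] A →L[ℂ] Cochain A n :=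
  (ContinuousMultilinearMap.curryMidEquiv ℂ (fun _ : Fin (n + 2) => A) ℂ
    p).toContinuousLinearEquiv.toContinuousLinearMap

theorem ins_seq (p : Fin (n + 2)) (f : Cochain A (n + 1)) (c : A) (a : ℕ → A) :
    (ins p f c).seq a = f.seq (insertAt p c a) := by
  change f (p.insertNth c fun i : Fin (n + 1) => a i) = f fun i : Fin (n + 2) => insertAt p c a i
  congr 1
  funext i
  refine Fin.succAboveCases p ?_ (fun k => ?_) i
  · simp [insertAt]
  · rw [Fin.insertNth_apply_succAbove]
    simp only [Fin.succAbove, insertAt, Fin.lt_def, Fin.val_castSucc]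
    split_ifs with h <;> grind

/-- The cochain obtained by applying a functional on `A*` to one argument of `f`. -/
def avg (E : (A →L[ℂ] ℂ) →L[ℂ] ℂ) (p : Fin (n + 2)) (f : Cochain A (n + 1)) : Cochain A n :=
  Cochain.ofCMM (E.compContinuousMultilinearMap
    (ContinuousLinearMap.flipMultilinear (E := fun _ : Fin (n + 1) => A) (G' := ℂ) (ins p f)))

theorem avg_seq (E : (A →L[ℂ] ℂ) →L[ℂ] ℂ) (p : Fin (n + 2)) (f : Cochain A (n + 1)) (a : ℕ → A) :
    (avg E p f).seq a = E ((Cochain.evalCLM n a).comp (ins p f)) := rfl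

variable [IsScalarTower ℂ A A] [SMulCommClass ℂ A A]

/-- The merge takes place strictly after the inserted entry, so the insertion only shifts the index
and costs a sign. The cyclic coface also touches slot `0`, hence `1 ≤ p` in that case. -/
theorem ins_coface_succ {p : Fin (n + 2)} {j : ℕ} (hp : (p : ℕ) ≤ j) (hj : j ≤ n + 1)
    (h : j = n + 1 → 1 ≤ (p : ℕ)) (f : Cochain A (n + 1)) (c : A) :
    ins p.castSucc (coface (n + 1) (j + 1) f) c = -coface n j (ins p f c) := by
  refine Cochain.ext_seq fun a => ?_
  rw [ins_seq, Cochain.neg_seq, Fin.val_castSucc]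
  rcases hj.lt_or_eq with hj | rfl
  · rw [coface_seq (by omega), coface_seq (by omega), ins_seq, mergeAt_insertAt_of_lt hp]
    ring
  · rw [coface_last_seq, coface_last_seq, ins_seq,
      mergeAt_rotateSeq_insertAt (h rfl) (by omega)]
    ring

theorem ins_coface_of_gt {p : Fin (n + 2)} {j : ℕ} (hj : j < (p : ℕ)) (f : Cochain A (n + 1))
    (c : A) : ins p.succ (coface (n + 1) j f) c = coface n j (ins p f c) := by
  refine Cochain.ext_seq fun a => ?_
  rw [ins_seq, coface_seq (by omega), coface_seq (by omega), ins_seq, Fin.val_succ,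
    mergeAt_insertAt_of_gt hj]

theorem coface_avg {j : ℕ} (hj : j ≤ n + 1) (E : (A →L[ℂ] ℂ) →L[ℂ] ℂ) (p : Fin (n + 2))
    (f : Cochain A (n + 1)) (a : ℕ → A) :
    (coface n j (avg E p f)).seq a = E ((Cochain.evalCLM (n + 1) a).comp
      (ContinuousLinearMap.comp ⟨coface n j, continuous_coface hj⟩ (ins p f))) := by
  rcases hj.lt_or_eq with hj | rfl
  · rw [coface_seq (by omega), avg_seq, ← smul_eq_mul, ← map_smul]
    congr 1
    ext c
    exact (coface_seq (show j ≤ n by omega) (ins p f c) a).symm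
  · rw [coface_last_seq, avg_seq, ← smul_eq_mul, ← map_smul]
    congr 1
    ext c
    exact (coface_last_seq n (ins p f c) a).symm

/-- Cofaces commute with applying `E` in a slot. Packaging their sum as `E φ` lets a mean identity
evaluate it once `φ` is known. -/
theorem exists_sum_coface_avg {s : Finset ℕ} (hs : ∀ j ∈ s, j ≤ n + 1)
    (E : (A →L[ℂ] ℂ) →L[ℂ] ℂ) (p : Fin (n + 2)) (f : Cochain A (n + 1)) (a : ℕ → A) :
    ∃ φ : A →L[ℂ] ℂ, (∀ c, φ c = ∑ j ∈ s, (coface n j (ins p f c)).seq a) ∧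
      ∑ j ∈ s, (coface n j (avg E p f)).seq a = E φ := by
  refine ⟨∑ j ∈ s.attach, (Cochain.evalCLM (n + 1) a).comp
      (ContinuousLinearMap.comp ⟨coface n j, continuous_coface (hs j j.2)⟩ (ins p f)), ?_, ?_⟩
  · intro c
    rw [← Finset.sum_attach s, _root_.sum_apply]
    rfl
  · rw [map_sum, ← Finset.sum_attach]
    exact Finset.sum_congr rfl fun j _ => coface_avg (hs j j.2) E p f a

end Insertion

/-! ### Means -/

section Means

variable {A : Type u} [NonUnitalNormedRing A] [NormedSpace ℂ A]

/-- `E ∈ A**` is a left identity for `J`: `E(φ(· c)) = φ(c)`, where only values on `J` matter. -/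
def IsLeftMean (J : Set A) (E : (A →L[ℂ] ℂ) →L[ℂ] ℂ) : Prop :=
  ∀ c ∈ J, ∀ φ ψ : A →L[ℂ] ℂ, (∀ e ∈ J, ψ e = φ (e * c)) → E ψ = φ c

/-- `E ∈ A**` is a right identity for `J`: `E(φ(c ·)) = φ(c)`, where only values on `J` matter. -/
def IsRightMean (J : Set A) (E : (A →L[ℂ] ℂ) →L[ℂ] ℂ) : Prop :=
  ∀ c ∈ J, ∀ φ ψ : A →L[ℂ] ℂ, (∀ e ∈ J, ψ e = φ (c * e)) → E ψ = φ c

/-- Weak-star compactness of bounded sets in the bidual, obtained by refining to an ultrafilter and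
taking limits functional by functional. -/
theorem exists_weakStar_limit (l : Filter A) [l.NeBot] (hl : ∃ C : ℝ, ∀ᶠ e in l, ‖e‖ ≤ C) :
    ∃ E : (A →L[ℂ] ℂ) →L[ℂ] ℂ, ∃ u : Filter A, u.NeBot ∧ u ≤ l ∧
      ∀ φ : A →L[ℂ] ℂ, Tendsto φ u (𝓝 (E φ)) := by
  obtain ⟨C, hC⟩ := hl
  have hu : ∀ᶠ e in (Ultrafilter.of l : Filter A), ‖e‖ ≤ C := Ultrafilter.of_le l hC
  have hlim : ∀ φ : A →L[ℂ] ℂ, ∃ z ∈ Metric.closedBall (0 : ℂ) (C * ‖φ‖),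
      Tendsto φ (Ultrafilter.of l : Filter A) (𝓝 z) := fun φ => by
    refine (isCompact_closedBall (0 : ℂ) (C * ‖φ‖)).ultrafilter_le_nhds
      ((Ultrafilter.of l).map φ) ?_
    rw [le_principal_iff]
    refine hu.mono fun e he => ?_
    rw [mem_closedBall_zero_iff, mul_comm]
    exact φ.le_opNorm_of_le he
  choose L hL hLt using hlim
  refine ⟨LinearMap.mkContinuous
    { toFun := L
      map_add' := fun φ ψ => tendsto_nhds_unique (hLt (φ + ψ)) ((hLt φ).add (hLt ψ))
      map_smul' := fun c φ => tendsto_nhds_unique (hLt (c • φ)) ((hLt φ).const_smul c) } C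
    fun φ => mem_closedBall_zero_iff.1 (hL φ), Ultrafilter.of l, inferInstance,
    Ultrafilter.of_le l, hLt⟩

theorem HasLeftBAI.exists_isLeftMean (h : HasLeftBAI A) :
    ∃ E : (A →L[ℂ] ℂ) →L[ℂ] ℂ, IsLeftMean Set.univ E := by
  obtain ⟨l, hl, hb, ht⟩ := h
  obtain ⟨E, u, hu, hul, hE⟩ := exists_weakStar_limit l hb
  refine ⟨E, fun c _ φ ψ h => ?_⟩
  have h1 : Tendsto (fun e => φ (e * c)) u (𝓝 (φ c)) :=
    (φ.continuous.tendsto c).comp ((ht c).mono_left hul)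
  exact tendsto_nhds_unique (hE ψ) (h1.congr fun e => (h e (Set.mem_univ e)).symm)

theorem HasRightBAI.exists_isRightMean (h : HasRightBAI A) :
    ∃ E : (A →L[ℂ] ℂ) →L[ℂ] ℂ, IsRightMean Set.univ E := by
  obtain ⟨l, hl, hb, ht⟩ := h
  obtain ⟨E, u, hu, hul, hE⟩ := exists_weakStar_limit l hb
  refine ⟨E, fun c _ φ ψ h => ?_⟩
  have h1 : Tendsto (fun e => φ (c * e)) u (𝓝 (φ c)) :=
    (φ.continuous.tendsto c).comp ((ht c).mono_left hul)
  exact tendsto_nhds_unique (hE ψ) (h1.congr fun e => (h e (Set.mem_univ e)).symm)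

end Means

/-! ### Consequences of amenability: essentiality, and a left identity in the bidual. -/

section Amenable

variable {B : Type u} [NonUnitalNormedRing B] [NormedSpace ℂ B]
  [IsScalarTower ℂ B B] [SMulCommClass ℂ B B]

omit [IsScalarTower ℂ B B] [SMulCommClass ℂ B B] in
/-- A bounded functional on an amenable algebra that vanishes on products is zero. -/
theorem IsAmenable.eq_zero_of_mul (hB : IsAmenable B) [CompleteSpace B] (φ : B →L[ℂ] ℂ)
    (hφ : ∀ a b, φ (a * b) = 0) : φ = 0 := by
  -- For zero actions the map `a ↦ φ a • φ` is a cocycle because `φ` kills products, and only `0` is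
  -- inner; evaluating at `a` gives `φ a ^ 2 = 0`.
  let m : BanachBimodule B B :=
    { left := 0, right := 0, left_mul := by simp, right_mul := by simp, left_right := by simp }
  obtain ⟨f, hf⟩ := hB B m (φ.smulRight φ) fun a b => by
    ext x
    simp [hφ, BanachBimodule.dual, m]
  ext a
  have h := congrArg (fun ψ : B →L[ℂ] ℂ => ψ a) (hf a)
  simpa [BanachBimodule.dual, m] using h

/-- The bidual of an amenable algebra has a left identity. -/
theorem IsAmenable.exists_bidual_left_one (hB : IsAmenable B) :
    ∃ E : (B →L[ℂ] ℂ) →L[ℂ] ℂ, ∀ (c : B) (φ ψ : B →L[ℂ] ℂ), (∀ e, ψ e = φ (e * c)) →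
      E ψ = φ c := by
  -- On `B*` let `c` act on the left by `φ ↦ φ(· c)` and on the right by zero. The canonical
  -- embedding of `B` into `B**` is then a cocycle; if `F` implements it, `φ c = -F (φ(· c))`.
  let m : BanachBimodule B (B →L[ℂ] ℂ) :=
    { left := ((ContinuousLinearMap.compL ℂ B B ℂ).flip).comp (ContinuousLinearMap.mul ℂ B).flip
      right := 0
      left_mul := fun a b φ => by ext x; simp [mul_assoc]
      right_mul := by simp
      left_right := by simp }
  obtain ⟨F, hF⟩ := hB (B →L[ℂ] ℂ) m (ContinuousLinearMap.apply ℂ ℂ) fun a b => by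
    ext φ
    simp [BanachBimodule.dual, m]
  refine ⟨-F, fun c φ ψ h => ?_⟩
  have h1 := congrArg (fun G : (B →L[ℂ] ℂ) →L[ℂ] ℂ => G φ) (hF c)
  have h2 : ψ = m.left c φ := by
    ext e
    simp [m, h]
  rw [h2]
  simpa [BanachBimodule.dual, m] using h1.symm

end Amenable

section Ideal

variable {A : Type u} [NonUnitalNormedRing A] [NormedSpace ℂ A]

/-- The inclusion of a closed ideal. -/
def ClosedIdeal.incl (I : ClosedIdeal A) : I.toNonUnitalSubalgebra →L[ℂ] A where
  toFun := Subtype.val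
  map_add' _ _ := rfl
  map_smul' _ _ := rfl
  cont := continuous_subtype_val

variable [IsScalarTower ℂ A A] [SMulCommClass ℂ A A]

/-- The left identity of the bidual of `I`, transported to `A**` by restricting functionals to `I`.
-/
theorem ClosedIdeal.exists_isLeftMean (I : ClosedIdeal A)
    (hI : IsAmenable I.toNonUnitalSubalgebra) :
    ∃ E : (A →L[ℂ] ℂ) →L[ℂ] ℂ, IsLeftMean (I.sub : Set A) E := by
  obtain ⟨E, hE⟩ := hI.exists_bidual_left_one
  refine ⟨E.comp ((ContinuousLinearMap.compL ℂ I.toNonUnitalSubalgebra A ℂ).flip I.incl),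
    fun c hc φ ψ h => ?_⟩
  exact hE ⟨c, hc⟩ (φ.comp I.incl) (ψ.comp I.incl) fun e => h e e.2

end Ideal

/-! ### Cochains vanishing on an ideal -/

section Vanishing

variable {A : Type u} [NonUnitalNormedRing A] [NormedSpace ℂ A] (I : ClosedIdeal A)

/-- The cochains of degree `n` that vanish if one of the arguments at positions `< p` is in `I`. -/
def vanishing (p n : ℕ) : Submodule ℂ (Cochain A n) where
  carrier := {f | ∀ (a : ℕ → A) (q : ℕ), q < p → q ≤ n → a q ∈ I.sub → f.seq a = 0}
  add_mem' hf hg a q hq hn h := by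
    rw [Cochain.add_seq, hf a q hq hn h, hg a q hq hn h, add_zero]
  zero_mem' _ _ _ _ _ := rfl
  smul_mem' c f hf a q hq hn h := by rw [Cochain.smul_seq, hf a q hq hn h, mul_zero]

variable {I}

/-- An entry in a two-sided ideal stays in it after a merge and never moves to the right. This is
why cofaces preserve vanishing on an initial block of slots. -/
theorem exists_mergeAt_mem {n j q : ℕ} (hj : j ≤ n) (hq : q ≤ n + 1) {a : ℕ → A}
    (h : a q ∈ I.sub) : ∃ r ≤ q, r ≤ n ∧ mergeAt j a r ∈ I.sub := by
  rcases lt_trichotomy q j with hqj | rfl | hqj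
  · exact ⟨q, le_rfl, by omega, by simpa [mergeAt, hqj] using h⟩
  · exact ⟨q, le_rfl, hj, by simpa [mergeAt] using I.mul_mem_right _ h⟩
  · obtain ⟨q, rfl⟩ : ∃ k, q = k + 1 := ⟨q - 1, by omega⟩
    refine ⟨q, by omega, by omega, ?_⟩
    rcases (Nat.lt_succ_iff.1 hqj).eq_or_lt with rfl | hqj
    · simpa [mergeAt] using I.mul_mem_left _ h
    · simpa [mergeAt, hqj.not_gt, hqj.ne'] using h

theorem exists_mergeAt_rotateSeq_mem {n q : ℕ} (hq : q ≤ n + 1) {a : ℕ → A}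
    (h : a q ∈ I.sub) : ∃ r ≤ q, r ≤ n ∧ mergeAt 0 (rotateSeq (n + 1) a) r ∈ I.sub := by
  rcases hq.lt_or_eq with hq | rfl
  · refine ⟨q, le_rfl, by omega, ?_⟩
    rcases Nat.eq_zero_or_pos q with rfl | hq
    · simpa [mergeAt, rotateSeq] using I.mul_mem_left _ h
    · simpa [mergeAt, rotateSeq, hq.ne'] using h
  · exact ⟨0, by omega, by omega, by simpa [mergeAt, rotateSeq] using I.mul_mem_right _ h⟩

theorem rotOp_mem_vanishing {n : ℕ} {f : Cochain A n} (hf : f ∈ vanishing I (n + 1) n) :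
    rotOp n f ∈ vanishing I (n + 1) n := by
  intro a q hq hn h
  rw [rotOp_seq]
  rcases hn.lt_or_eq with hn | rfl
  · rw [hf (rotateSeq n a) (q + 1) (by omega) (by omega) (by simpa [rotateSeq] using h), mul_zero]
  · rw [hf (rotateSeq q a) 0 (by omega) (by omega) (by simpa [rotateSeq] using h), mul_zero]

theorem rotOp_pow_mem_vanishing {n : ℕ} (k : ℕ) {f : Cochain A n}
    (hf : f ∈ vanishing I (n + 1) n) : (rotOp n ^ k) f ∈ vanishing I (n + 1) n := by
  induction k with
  | zero => exact hf
  | succ k ih =>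
    rw [pow_succ', Module.End.mul_apply]
    exact rotOp_mem_vanishing ih

theorem normOp_mem_vanishing {n : ℕ} {f : Cochain A n} (hf : f ∈ vanishing I (n + 1) n) :
    normOp n f ∈ vanishing I (n + 1) n := by
  rw [normOp, LinearMap.sum_apply]
  exact Submodule.sum_mem _ fun k _ => rotOp_pow_mem_vanishing k hf

theorem normHomotopy_mem_vanishing {n : ℕ} {f : Cochain A n} (hf : f ∈ vanishing I (n + 1) n) :
    normHomotopy n f ∈ vanishing I (n + 1) n := by
  rw [normHomotopy, LinearMap.sum_apply]
  refine Submodule.sum_mem _ fun k _ => ?_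
  rw [LinearMap.sum_apply]
  exact Submodule.sum_mem _ fun j _ => rotOp_pow_mem_vanishing j hf

theorem avg_mem_vanishing {n k : ℕ} (E : (A →L[ℂ] ℂ) →L[ℂ] ℂ) {p : Fin (n + 2)}
    {f : Cochain A (n + 1)} (hk : k ≤ p) (hf : f ∈ vanishing I k (n + 1)) :
    avg E p f ∈ vanishing I k n := by
  intro a q hq hn h
  have h0 : (Cochain.evalCLM n a).comp (ins p f) = 0 := by
    ext c
    change (ins p f c).seq a = 0
    rw [ins_seq]
    exact hf _ q hq (by omega) (by simpa [insertAt, show q < (p : ℕ) by omega] using h)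
  rw [avg_seq, h0, map_zero]

theorem ins_mem_vanishing {n k : ℕ} (c : A) {p : Fin (n + 2)}
    {f : Cochain A (n + 1)} (hk : k ≤ p) (hf : f ∈ vanishing I k (n + 1)) :
    ins p f c ∈ vanishing I k n := by
  intro a q hq hn h
  rw [ins_seq]
  exact hf _ q hq (by omega) (by simpa [insertAt, show q < (p : ℕ) by omega] using h)

variable [IsScalarTower ℂ A A] [SMulCommClass ℂ A A]

theorem coface_mem_vanishing {n j p : ℕ} (hj : j ≤ n + 1) {f : Cochain A n}
    (hf : f ∈ vanishing I p n) : coface n j f ∈ vanishing I p (n + 1) := by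
  intro a q hq hn h
  rcases hj.lt_or_eq with hj | rfl
  · obtain ⟨r, hr, hrn, hm⟩ := exists_mergeAt_mem (Nat.lt_succ_iff.1 hj) hn h
    rw [coface_seq (by omega), hf _ r (by omega) hrn hm, mul_zero]
  · obtain ⟨r, hr, hrn, hm⟩ := exists_mergeAt_rotateSeq_mem hn h
    rw [coface_last_seq, hf _ r (by omega) hrn hm, mul_zero]

-- When `n < p` all `n + 1` slots are already covered, so the bound `q` is immaterial.
omit [IsScalarTower ℂ A A] [SMulCommClass ℂ A A] in
theorem vanishing_mono {n p q : ℕ} (h : n < p) : vanishing I p n ≤ vanishing I q n :=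
  fun _ hf a r _ hrn hm => hf a r (by omega) hrn hm

theorem barCoboundary_mem_vanishing {n : ℕ} {f : Cochain A n}
    (hf : f ∈ vanishing I (n + 1) n) : barCoboundary n f ∈ vanishing I (n + 2) (n + 1) := by
  rw [barCoboundary, LinearMap.sum_apply]
  exact Submodule.sum_mem _ fun j hj => coface_mem_vanishing
    (by have := Finset.mem_range.1 hj; omega) (vanishing_mono n.lt_succ_self hf)

theorem coboundary_mem_vanishing {n : ℕ} {f : Cochain A n}
    (hf : f ∈ vanishing I (n + 1) n) : coboundary n f ∈ vanishing I (n + 2) (n + 1) := by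
  rw [coboundary_eq_sum, LinearMap.sum_apply]
  exact Submodule.sum_mem _ fun j hj => coface_mem_vanishing
    (by have := Finset.mem_range.1 hj; omega) (vanishing_mono n.lt_succ_self hf)

/-- Modulo cochains vanishing on `I`, the complex of `barCoboundary` is exact. -/
theorem exists_sub_barCoboundary_mem_vanishing (hA : HasLeftBAI A ∨ HasRightBAI A) {n : ℕ}
    {f : Cochain A (n + 1)} (hf : barCoboundary (n + 1) f ∈ vanishing I (n + 3) (n + 2)) :
    ∃ g : Cochain A n, f - barCoboundary n g ∈ vanishing I (n + 2) (n + 1) := by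
  rw [barCoboundary, LinearMap.sum_apply] at hf
  rcases hA with hA | hA
  · obtain ⟨E, hE⟩ := hA.exists_isLeftMean
    -- Contracting homotopy: evaluating `b' f` at `(e, a₀, …)` gives `f(e a₀, a₁, …)` minus `b'` of
    -- `f(e, …)` at `a`, and averaging over `e` turns the former into `f a`.
    refine ⟨avg E 0 f, fun a q hq hn h => ?_⟩
    obtain ⟨ψ, hψ, hEψ⟩ := exists_sum_coface_avg (s := Finset.range (n + 1))
      (fun j hj => by have := Finset.mem_range.1 hj; omega) E 0 f a
    rw [Cochain.sub_seq, barCoboundary, LinearMap.sum_apply, Cochain.sum_seq, hEψ]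
    have h1 : ∀ x, insertAt 0 x (fun i => a (i + 1)) = fun i => if i = 0 then x else a i := by
      intro x
      funext i
      grind [insertAt]
    have h2 := hE (a 0) (Set.mem_univ _)
      ((Cochain.evalCLM n fun i => a (i + 1)).comp (ins 0 f)) ψ fun e _ => by
        have h3 := hf (insertAt 0 e a) (q + 1) (by omega) (by omega) (by simpa [insertAt] using h)
        rw [Cochain.sum_seq, Finset.sum_range_succ'] at h3
        have h4 : ∀ j ∈ Finset.range (n + 1),
            (coface (n + 1) (j + 1) f).seq (insertAt 0 e a) = -(coface n j (ins 0 f e)).seq a := by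
          intro j hj
          have hj' := Finset.mem_range.1 hj
          have h5 := congrArg (fun g => Cochain.seq g a)
            (ins_coface_succ (p := (0 : Fin (n + 2))) (j := j) (by simp) (by omega) (by omega) f e)
          rwa [ins_seq] at h5
        rw [Finset.sum_congr rfl h4, Finset.sum_neg_distrib, ← hψ, coface_seq (by omega)] at h3
        change ψ e = (ins 0 f (e * a 0)).seq fun i => a (i + 1)
        rw [ins_seq, Fin.val_zero, h1]
        have h6 : mergeAt 0 (insertAt 0 e a) = fun i => if i = 0 then e * a 0 else a i := by
          funext i
          grind [mergeAt, insertAt]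
        rw [h6] at h3
        linear_combination -h3
    change E ψ = (ins 0 f (a 0)).seq (fun i => a (i + 1)) at h2
    rw [ins_seq, Fin.val_zero, h1] at h2
    rw [h2, sub_eq_zero]
    congr 1
    funext i
    split_ifs with hi <;> simp [hi]
  · obtain ⟨E, hE⟩ := hA.exists_isRightMean
    -- The mirror image with `e` in the last slot. There `f(…, a_{n+1} e)` carries the sign `(-1) ^
    -- (n + 1)`, which explains the factor.
    refine ⟨(-1 : ℂ) ^ n • avg E (Fin.last (n + 1)) f, fun a q hq hn h => ?_⟩
    obtain ⟨ψ, hψ, hEψ⟩ := exists_sum_coface_avg (s := Finset.range (n + 1))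
      (fun j hj => by have := Finset.mem_range.1 hj; omega) E (Fin.last (n + 1)) f a
    rw [Cochain.sub_seq, barCoboundary, map_smul, Cochain.smul_seq, LinearMap.sum_apply,
      Cochain.sum_seq, hEψ]
    have h2 := hE (a (n + 1)) (Set.mem_univ _)
      ((-1 : ℂ) ^ n • (Cochain.evalCLM n a).comp (ins (Fin.last (n + 1)) f)) ψ fun e _ => by
        have h3 := hf (insertAt (n + 2) e a) q (by omega) (by omega)
          (by simpa [insertAt, show q < n + 2 by omega] using h)
        rw [Cochain.sum_seq, Finset.sum_range_succ] at h3
        have h4 : ∀ j ∈ Finset.range (n + 1), (coface (n + 1) j f).seq (insertAt (n + 2) e a) =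
            (coface n j (ins (Fin.last (n + 1)) f e)).seq a := by
          intro j hj
          have hj' := Finset.mem_range.1 hj
          have h5 := congrArg (fun g => Cochain.seq g a)
            (ins_coface_of_gt (p := Fin.last (n + 1)) (j := j) (by simpa using hj') f e)
          rwa [ins_seq] at h5
        rw [Finset.sum_congr rfl h4, ← hψ, coface_seq (by omega)] at h3
        change ψ e = (-1 : ℂ) ^ n * (ins (Fin.last (n + 1)) f (a (n + 1) * e)).seq a
        rw [ins_seq, Fin.val_last]
        have h6 : ∀ k ≤ n + 1, mergeAt (n + 1) (insertAt (n + 2) e a) k =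
            insertAt (n + 1) (a (n + 1) * e) a k := by
          intro k hk
          grind [mergeAt, insertAt]
        rw [f.seq_congr h6] at h3
        linear_combination h3
    change E ψ = (-1 : ℂ) ^ n * (ins (Fin.last (n + 1)) f (a (n + 1))).seq a at h2
    rw [ins_seq, Fin.val_last] at h2
    have h7 : ∀ k ≤ n + 1, insertAt (n + 1) (a (n + 1)) a k = a k := by
      intro k hk
      grind [insertAt]
    rw [h2, f.seq_congr h7, ← mul_assoc, ← mul_pow]
    simp

/-- One more slot is gained by averaging over `e` in `I` inserted just before `a p`. In `δ f` at
this sequence the cofaces before `p` vanish, the one at `p` gives `f(…, e a_p, …)`, and the later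
ones reassemble the coboundary of the average. The mean of `I` suffices because `a p` lies in `I`.
-/
theorem sub_coboundary_avg_mem_vanishing {n : ℕ} {E : (A →L[ℂ] ℂ) →L[ℂ] ℂ}
    (hE : IsLeftMean (I.sub : Set A) E) {p : Fin (n + 2)} (hp : 1 ≤ (p : ℕ))
    {f : Cochain A (n + 1)} (hfp : f ∈ vanishing I p (n + 1))
    (hf : coboundary (n + 1) f ∈ vanishing I (n + 3) (n + 2)) :
    f - coboundary n ((-1 : ℂ) ^ (p : ℕ) • avg E p f) ∈ vanishing I (p + 1) (n + 1) := by
  have hcob : coboundary n (avg E p f) ∈ vanishing I p (n + 1) := by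
    rw [coboundary_eq_sum, LinearMap.sum_apply]
    exact Submodule.sum_mem _ fun j hj => coface_mem_vanishing
      (by have := Finset.mem_range.1 hj; omega) (avg_mem_vanishing E le_rfl hfp)
  intro a q hq hn h
  rw [map_smul]
  rcases (Nat.lt_succ_iff.1 hq).lt_or_eq with hqp | rfl
  · exact Submodule.sub_mem _ hfp (Submodule.smul_mem _ _ hcob) a q hqp hn h
  obtain ⟨ψ, hψ, hEψ⟩ := exists_sum_coface_avg (s := Finset.range (n + 2))
    (fun j hj => by have := Finset.mem_range.1 hj; omega) E p f a
  rw [Cochain.sub_seq, Cochain.smul_seq, coboundary_eq_sum, LinearMap.sum_apply, Cochain.sum_seq,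
    hEψ]
  -- The sequence `a` with entry `p` deleted, so that inserting `a p` at `p` restores `a`.
  set b : ℕ → A := fun i => if i < p then a i else a (i + 1) with hb
  have hab : ∀ x, insertAt p x b = fun i : ℕ => if i = (p : ℕ) then x else a i := by
    intro x
    funext i
    grind [insertAt]
  have hab' : insertAt p (a p) b = a := by
    rw [hab]
    funext i
    split_ifs with hi <;> simp [hi]
  have h2 := hE (a p) h ((-1 : ℂ) ^ (p : ℕ) • (Cochain.evalCLM n b).comp (ins p f)) ψ fun e he => by
    obtain ⟨m, hm⟩ : ∃ m, n + 2 = p + m := ⟨n + 2 - p, by omega⟩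
    have h3 := hf (insertAt p e a) p (by omega) (by omega) (by simpa [insertAt] using he)
    rw [coboundary_eq_sum, LinearMap.sum_apply, Cochain.sum_seq,
      show n + 1 + 2 = p + (m + 1) by omega, Finset.sum_range_add, Finset.sum_range_succ' _ m]
      at h3
    have hsplit : ∀ g : ℕ → ℂ, ∑ j ∈ Finset.range (n + 2), g j =
        ∑ j ∈ Finset.range p, g j + ∑ j ∈ Finset.range m, g (p + j) := fun g => by
      rw [← Finset.sum_range_add, ← hm]
    rw [hψ, hsplit]
    -- A merge before the inserted entry moves it to slot `p - 1`, alone or multiplied by `a (p -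
    -- 1)`; it stays in `I`, where `f` already vanishes.
    have h4 : ∀ j ∈ Finset.range p, (coface (n + 1) j f).seq (insertAt p e a) = 0 := by
      intro j hj
      have hj' := Finset.mem_range.1 hj
      rw [coface_seq (by omega)]
      rcases (Nat.le_sub_one_of_lt hj').lt_or_eq with hj1 | hj1
      · rw [hfp _ (p - 1) (by omega) (by omega) (by
          have : mergeAt j (insertAt p e a) (p - 1) = e := by grind [mergeAt, insertAt]
          rw [this]; exact he), mul_zero]
      · rw [hfp _ (p - 1) (by omega) (by omega) (by
          have : mergeAt j (insertAt p e a) (p - 1) = a (p - 1) * e := by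
            grind [mergeAt, insertAt]
          rw [this]; exact I.mul_mem_left _ he), mul_zero]
    have h5 : ∀ j ∈ Finset.range p, (coface n j (ins p f e)).seq a = 0 := by
      intro j hj
      have hj' := Finset.mem_range.1 hj
      have hins : ins p f e ∈ vanishing I p n := ins_mem_vanishing e le_rfl hfp
      rw [coface_seq (by omega)]
      rcases (Nat.le_sub_one_of_lt hj').lt_or_eq with hj1 | hj1
      · rw [hins _ (p - 1) (by omega) (by omega) (by
          have : mergeAt j a (p - 1) = a p := by grind [mergeAt]
          rw [this]; exact h), mul_zero]
      · rw [hins _ (p - 1) (by omega) (by omega) (by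
          have : mergeAt j a (p - 1) = a (p - 1) * a p := by grind [mergeAt]
          rw [this]; exact I.mul_mem_left _ h), mul_zero]
    have h6 : ∀ j ∈ Finset.range m, (coface (n + 1) (p + (j + 1)) f).seq (insertAt p e a) =
        -(coface n (p + j) (ins p f e)).seq a := by
      intro j hj
      have hj' := Finset.mem_range.1 hj
      have h7 := congrArg (fun g => Cochain.seq g a)
        (ins_coface_succ (p := p) (j := p + j) (by omega) (by omega) (by omega) f e)
      rwa [ins_seq] at h7
    rw [Finset.sum_congr rfl h4, Finset.sum_congr rfl h6, Finset.sum_const_zero,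
      Finset.sum_neg_distrib, add_zero, coface_seq (by omega)] at h3
    rw [Finset.sum_congr rfl h5, Finset.sum_const_zero]
    change _ = (-1 : ℂ) ^ (p : ℕ) * (ins p f (e * a p)).seq b
    rw [ins_seq, ← mergeAt_insertAt_insertAt, hab']
    linear_combination -h3
  change E ψ = (-1 : ℂ) ^ (p : ℕ) * (ins p f (a p)).seq b at h2
  rw [ins_seq, hab'] at h2
  rw [h2, ← mul_assoc, ← mul_pow]
  simp

end Vanishing

/-! ### Cochains as a dual space -/

set_option maxSynthPendingDepth 3

section Predual

variable {A : Type u} [NonUnitalNormedRing A] [NormedSpace ℂ A]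

/-- The closed span of the evaluations; its dual is the space of cochains. -/
def predual (A : Type u) [NonUnitalNormedRing A] [NormedSpace ℂ A] (n : ℕ) :
    Submodule ℂ (Cochain A n →L[ℂ] ℂ) :=
  (Submodule.span ℂ (Set.range (Cochain.evalCLM n))).topologicalClosure

theorem isClosed_predual (n : ℕ) : IsClosed (predual A n : Set (Cochain A n →L[ℂ] ℂ)) :=
  Submodule.isClosed_topologicalClosure _

instance (n : ℕ) : CompleteSpace (predual A n) :=
  (isClosed_predual n).completeSpace_coe

theorem evalCLM_mem_predual (n : ℕ) (a : ℕ → A) : Cochain.evalCLM n a ∈ predual A n :=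
  Submodule.le_topologicalClosure _ (Submodule.subset_span ⟨a, rfl⟩)

/-- Extend to all functionals by Hahn–Banach and evaluate at the evaluations; both sides agree on
their closed span. Amenability speaks only of dual modules, hence the need for a predual. -/
theorem exists_cochain_of_predual {n : ℕ} (x : predual A n →L[ℂ] ℂ) :
    ∃ g : Cochain A n, ∀ φ : predual A n, x φ = φ.1 g := by
  obtain ⟨y, hy, -⟩ := exists_extension_norm_eq (predual A n) x
  let g : Cochain A n := Cochain.ofCMM (y.compContinuousMultilinearMap
    (ContinuousLinearMap.flipMultilinear (E := fun _ : Fin (n + 1) => A) (G' := ℂ)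
      (ContinuousLinearMap.id ℂ (Cochain A n))))
  have hg : Set.EqOn y (ContinuousLinearMap.apply ℂ ℂ g) (Set.range (Cochain.evalCLM n)) := by
    rintro _ ⟨a, rfl⟩
    rfl
  refine ⟨g, fun φ => ?_⟩
  rw [← hy]
  exact ContinuousLinearMap.eqOn_closure_span hg φ.2

theorem comp_mem_predual {n : ℕ} {T : Cochain A n →L[ℂ] Cochain A n}
    (hT : ∀ a, (Cochain.evalCLM n a).comp T ∈ predual A n) {φ : Cochain A n →L[ℂ] ℂ}
    (hφ : φ ∈ predual A n) : φ.comp T ∈ predual A n := by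
  let R : (Cochain A n →L[ℂ] ℂ) →L[ℂ] (Cochain A n →L[ℂ] ℂ) :=
    (ContinuousLinearMap.compL ℂ (Cochain A n) (Cochain A n) ℂ).flip T
  have h : predual A n ≤ (predual A n).comap R.toLinearMap := by
    refine Submodule.topologicalClosure_minimal _ (Submodule.span_le.2 ?_)
      ((isClosed_predual n).preimage R.continuous)
    rintro _ ⟨a, rfl⟩
    exact hT a
  exact h hφ

variable {B : Type u} [NonUnitalNormedRing B] [NormedSpace ℂ B]

/-- The action on the predual induced by an action on cochains. -/
def predualAction {n : ℕ} (T : B →L[ℂ] Cochain A n →L[ℂ] Cochain A n)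
    (hT : ∀ b a, (Cochain.evalCLM n a).comp (T b) ∈ predual A n) :
    B →L[ℂ] predual A n →L[ℂ] predual A n :=
  LinearMap.mkContinuous₂
    (LinearMap.mk₂ ℂ (fun b φ => ⟨φ.1.comp (T b), comp_mem_predual (hT b) φ.2⟩)
      (fun b c φ => by ext; simp) (fun r b φ => by ext; simp)
      (fun b φ ψ => by ext; simp) (fun r b φ => by ext; simp)) ‖T‖ fun b φ => by
    calc ‖φ.1.comp (T b)‖ ≤ ‖φ.1‖ * ‖T b‖ := φ.1.opNorm_comp_le _
      _ ≤ ‖φ.1‖ * (‖T‖ * ‖b‖) := by gcongr; exact T.le_opNorm b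
      _ = ‖T‖ * ‖b‖ * ‖φ‖ := by rw [mul_comm]; rfl

theorem predualAction_coe {n : ℕ} (T : B →L[ℂ] Cochain A n →L[ℂ] Cochain A n)
    (hT : ∀ b a, (Cochain.evalCLM n a).comp (T b) ∈ predual A n) (b : B) (φ : predual A n) :
    (predualAction T hT b φ).1 = φ.1.comp (T b) := rfl

/-- Derivations of an amenable algebra into a bimodule of cochains are inner. -/
theorem IsAmenable.exists_eq_sub [IsScalarTower ℂ B B] [SMulCommClass ℂ B B]
    (hB : IsAmenable B) {n : ℕ} (L R : B →L[ℂ] Cochain A n →L[ℂ] Cochain A n)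
    (hLL : ∀ a b h, L (a * b) h = L a (L b h)) (hRR : ∀ a b h, R (a * b) h = R b (R a h))
    (hLR : ∀ a b h, R b (L a h) = L a (R b h))
    (hL : ∀ b a, (Cochain.evalCLM n a).comp (L b) ∈ predual A n)
    (hR : ∀ b a, (Cochain.evalCLM n a).comp (R b) ∈ predual A n)
    (D : B →L[ℂ] Cochain A n) (hD : ∀ a b, L a (D b) - D (a * b) + R b (D a) = 0) :
    ∃ g : Cochain A n, ∀ b, D b = L b g - R b g := by
  let m : BanachBimodule B (predual A n) :=
    { left := predualAction R hR
      right := predualAction L hL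
      left_mul := fun a b φ => by
        ext h
        simp only [predualAction_coe, ContinuousLinearMap.comp_apply, hRR]
      right_mul := fun a b φ => by
        ext h
        simp only [predualAction_coe, ContinuousLinearMap.comp_apply, hLL]
      left_right := fun a b φ => by
        ext h
        simp only [predualAction_coe, ContinuousLinearMap.comp_apply, hLR] }
  let D' : B →L[ℂ] (predual A n →L[ℂ] ℂ) :=
    ((ContinuousLinearMap.compL ℂ (predual A n) (Cochain A n →L[ℂ] ℂ) ℂ).flip
      (predual A n).subtypeL).comp ((ContinuousLinearMap.apply ℂ ℂ).comp D)
  obtain ⟨x, hx⟩ := hB (predual A n) m D' fun a b => by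
    ext φ
    change φ.1 (L a (D b)) - φ.1 (D (a * b)) + φ.1 (R b (D a)) = 0
    rw [← map_sub, ← map_add, hD, map_zero]
  obtain ⟨g, hg⟩ := exists_cochain_of_predual x
  refine ⟨g, fun b => Cochain.ext_seq fun a => ?_⟩
  have h := congrArg (fun ψ : predual A n →L[ℂ] ℂ => ψ ⟨_, evalCLM_mem_predual n a⟩) (hx b)
  change (D b).seq a = x (predualAction L hL b _) - x (predualAction R hR b _) at h
  rw [h, hg, hg]
  rfl

end Predual

/-! ### Reduction to derivations, and relative exactness of the Hochschild complex. -/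

section FirstPosition

variable {A : Type u} [NonUnitalNormedRing A] [NormedSpace ℂ A]
  [IsScalarTower ℂ A A] [SMulCommClass ℂ A A] {n : ℕ}

theorem ins_ins_coface_one (k : Cochain A (n + 1)) (c d : A) :
    ins 1 (ins 1 (coface (n + 1) 1 k) c) d = -ins 1 k (c * d) := by
  refine Cochain.ext_seq fun a => ?_
  rw [ins_seq, ins_seq, Cochain.neg_seq, ins_seq, coface_seq (by omega), Fin.val_one, Fin.val_one,
    mergeAt_insertAt_insertAt]
  ring

theorem ins_ins_coface_zero (k : Cochain A (n + 1)) (c d : A) :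
    ins 1 (ins 1 (coface (n + 1) 0 k) c) d = ins 1 (coface n 0 (ins 1 k d)) c := by
  refine Cochain.ext_seq fun a => ?_
  rw [ins_seq, ins_seq, ins_seq, coface_seq (by omega), coface_seq (by omega), ins_seq,
    Fin.val_one, Fin.val_one]
  congr 2
  funext i
  grind [mergeAt, insertAt]

theorem ins_tailCoboundary (k : Cochain A (n + 1)) (c : A) :
    ins 1 (tailCoboundary (n + 1) k) c =
      ins 1 (coface (n + 1) 1 k) c - tailCoboundary n (ins 1 k c) := by
  have h : ∀ j ∈ Finset.range (n + 1),
      ins 1 (coface (n + 1) (j + 1 + 1) k) c = -coface n (j + 1) (ins 1 k c) := fun j hj =>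
    ins_coface_succ (p := (1 : Fin (n + 2))) (j := j + 1) (by simp)
      (by have := Finset.mem_range.1 hj; omega) (by simp) k c
  rw [tailCoboundary, LinearMap.sum_apply, Finset.sum_range_succ', map_add, map_sum, add_apply,
    sum_apply, Finset.sum_congr rfl h, Finset.sum_neg_distrib, tailCoboundary,
    LinearMap.sum_apply]
  abel

theorem tailCoboundary_coface_zero (h : Cochain A n) :
    tailCoboundary (n + 1) (coface n 0 h) =
      coface (n + 1) 1 (coface n 0 h) - coface (n + 1) 0 (tailCoboundary n h) := by
  have h1 : ∀ j ∈ Finset.range (n + 1), coface (n + 1) (j + 1 + 1) (coface n 0 h) =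
      -coface (n + 1) 0 (coface n (j + 1) h) := fun j hj =>
    coface_coface (by omega) (by have := Finset.mem_range.1 hj; omega) h
  rw [tailCoboundary, LinearMap.sum_apply, Finset.sum_range_succ', Finset.sum_congr rfl h1,
    Finset.sum_neg_distrib, tailCoboundary, LinearMap.sum_apply, map_sum]
  abel

variable (I : ClosedIdeal A)

/-- The action `h ↦ (T h)(·, c, …)` of an ideal on cochains. -/
def insAction (T : Cochain A n →ₗ[ℂ] Cochain A (n + 1)) (hT : Continuous T) :
    I.toNonUnitalSubalgebra →L[ℂ] Cochain A n →L[ℂ] Cochain A n :=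
  (((ins 1).comp ⟨T, hT⟩).flip).comp I.incl

omit [IsScalarTower ℂ A A] [SMulCommClass ℂ A A] in
theorem evalCLM_comp_insAction_mem (T : Cochain A n →ₗ[ℂ] Cochain A (n + 1)) (hT : Continuous T)
    (h : ∀ a, ∃ (s : Finset ℕ) (r : ℕ → ℂ) (b : ℕ → ℕ → A),
      ∀ k : Cochain A n, (T k).seq a = ∑ j ∈ s, r j * k.seq (b j))
    (c : I.toNonUnitalSubalgebra) (a : ℕ → A) :
    (Cochain.evalCLM n a).comp (insAction I T hT c) ∈ predual A n := by
  obtain ⟨s, r, b, hs⟩ := h (insertAt 1 c a)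
  have h1 : (Cochain.evalCLM n a).comp (insAction I T hT c) =
      ∑ j ∈ s, r j • Cochain.evalCLM n (b j) := by
    ext k
    rw [sum_apply]
    change (ins 1 (T k) (c : A)).seq a = ∑ j ∈ s, r j * k.seq (b j)
    rw [ins_seq]
    exact hs k
  rw [h1]
  exact Submodule.sum_mem _ fun j _ => Submodule.smul_mem _ _ (evalCLM_mem_predual n _)

theorem exists_coface_seq_eq {j : ℕ} (hj : j ≤ n + 1) (a : ℕ → A) :
    ∃ (r : ℂ) (b : ℕ → A), ∀ k : Cochain A n, (coface n j k).seq a = r * k.seq b := by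
  rcases hj.lt_or_eq with hj | rfl
  · exact ⟨_, _, fun k => coface_seq (by omega) k a⟩
  · exact ⟨_, _, fun k => coface_last_seq n k a⟩

variable {I}

/-- A cochain whose coboundary vanishes on an amenable ideal can be corrected so that it vanishes
if one of its first two arguments is in the ideal. -/
theorem exists_sub_coboundary_mem_vanishing_two [CompleteSpace A]
    (hI : IsAmenable I.toNonUnitalSubalgebra) {f : Cochain A (n + 1)}
    (hf : coboundary (n + 1) f ∈ vanishing I (n + 3) (n + 2)) :
    ∃ g : Cochain A n, f - coboundary n g ∈ vanishing I 2 (n + 1) := by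
  -- Johnson's reduction of dimension: with these actions on cochains, `c ↦ f(·, c, …)` is a
  -- derivation of `I`, and `L c g - R c g` is `δ g` with `c` in slot `1`.
  let L := insAction I (coface (A := A) n 0) (continuous_coface (Nat.zero_le _))
  let R := -insAction I (tailCoboundary (A := A) n) (continuous_tailCoboundary n)
  have hLdef : ∀ (c : I.toNonUnitalSubalgebra) h, L c h = ins 1 (coface n 0 h) (c : A) :=
    fun _ _ => rfl
  have hRdef : ∀ (c : I.toNonUnitalSubalgebra) h, R c h = -ins 1 (tailCoboundary n h) (c : A) :=
    fun _ _ => rfl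
  have hmul : ∀ c d : I.toNonUnitalSubalgebra, ((c * d : I.toNonUnitalSubalgebra) : A) = c * d :=
    fun _ _ => rfl
  have hD : ∀ c d : I.toNonUnitalSubalgebra,
      L c (ins 1 f (d : A)) - ins 1 f ((c : A) * d) + R d (ins 1 f (c : A)) = 0 := fun c d => by
    have h1 : ins 1 (ins 1 (coboundary (n + 1) f) (c : A)) (d : A) = 0 := by
      refine Cochain.ext_seq fun a => ?_
      rw [ins_seq, ins_seq]
      exact hf _ 1 (by omega) (by omega) (by simp [insertAt])
    rw [coboundary_eq_tail, LinearMap.add_apply, map_add, add_apply, map_add, add_apply,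
      ins_tailCoboundary, map_sub, sub_apply, ins_ins_coface_one, ins_ins_coface_zero] at h1
    rw [hLdef, hRdef, ← h1]
    abel
  -- The bimodule axioms follow from the coface relation for indices `0` and `1`, from the square of
  -- the tail coboundary being zero, and from its commutation with the zeroth coface.
  obtain ⟨g, hg⟩ := hI.exists_eq_sub L R
    (fun c d h => by
      rw [hLdef, hLdef, hLdef, hmul, ← ins_ins_coface_zero, ← neg_neg (ins 1 _ ((c : A) * d)),
        ← ins_ins_coface_one, coface_coface Nat.zero_lt_one (by omega)]
      simp)
    (fun c d h => by
      have h1 := ins_tailCoboundary (tailCoboundary n h) (c : A)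
      rw [tailCoboundary_tailCoboundary, map_zero, zero_apply, eq_comm, sub_eq_zero] at h1
      rw [hRdef, hRdef, hRdef, map_neg, map_neg, neg_apply, neg_neg, ← h1, ins_ins_coface_one,
        hmul])
    (fun c d h => by
      have h1 := ins_tailCoboundary (coface n 0 h) (c : A)
      rw [hLdef, hRdef, hRdef, hLdef, map_neg, map_neg, neg_apply, ← ins_ins_coface_zero,
        eq_sub_of_add_eq' (sub_eq_iff_eq_add.1 h1.symm).symm, tailCoboundary_coface_zero]
      simp)
    (evalCLM_comp_insAction_mem I _ _ fun a => by
      obtain ⟨r, b, h⟩ := exists_coface_seq_eq (n := n) (Nat.zero_le _) a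
      exact ⟨{0}, fun _ => r, fun _ => b, fun k => by rw [Finset.sum_singleton, h]⟩)
    (fun c a => by
      have h := evalCLM_comp_insAction_mem I (tailCoboundary n) (continuous_tailCoboundary n)
        (fun a => by
          have h : ∀ j, ∃ (r : ℂ) (b : ℕ → A), j ∈ Finset.range (n + 1) →
              ∀ k : Cochain A n, (coface n (j + 1) k).seq a = r * k.seq b := fun j => by
            by_cases hj : j < n + 1
            · obtain ⟨r, b, h⟩ := exists_coface_seq_eq (n := n) (j := j + 1) (by omega) a
              exact ⟨r, b, fun _ => h⟩
            · exact ⟨0, a, fun h => absurd (Finset.mem_range.1 h) hj⟩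
          choose r b h using h
          exact ⟨Finset.range (n + 1), r, b, fun k => by
            rw [tailCoboundary, LinearMap.sum_apply, Cochain.sum_seq]
            exact Finset.sum_congr rfl fun j hj => h j hj k⟩) c a
      exact Submodule.neg_mem _ h)
    ((ins 1 f).comp I.incl) hD
  refine ⟨g, ?_⟩
  set F := f - coboundary n g with hF
  have hFδ : coboundary (n + 1) F = coboundary (n + 1) f := by
    rw [hF, map_sub, coboundary_coboundary, sub_zero]
  have h1 : ∀ c ∈ I.sub, ins 1 F c = 0 := fun c hc => by
    have h2 : ins 1 f c = ins 1 (coface n 0 g) c - -ins 1 (tailCoboundary n g) c := hg ⟨c, hc⟩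
    rw [hF, map_sub, sub_apply, h2, coboundary_eq_tail, LinearMap.add_apply, map_add, add_apply]
    abel
  have hone : ∀ a : ℕ → A, a 1 ∈ I.sub → F.seq a = 0 := fun a ha => by
    have h2 := congrArg (fun h => Cochain.seq h fun i => if i = 0 then a 0 else a (i + 1))
      (h1 _ ha)
    have h3 : insertAt 1 (a 1) (fun i => if i = 0 then a 0 else a (i + 1)) = a := by
      funext i
      grind [insertAt]
    simpa only [ins_seq, Fin.val_one, h3, Cochain.zero_seq] using h2
  -- For `x` and `c` in `I`, the vanishing of `δ F` at `(x, c, …)` leaves only `F(x c, …) = 0`, as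
  -- all other terms have an element of `I` in slot `1`. A functional on `I` that kills products is
  -- zero.
  have hzero : ∀ a : ℕ → A, a 0 ∈ I.sub → F.seq a = 0 := fun a ha => by
    let b : ℕ → A := fun i => a (i + 1)
    have hb : ∀ x, insertAt 0 x b = fun i => if i = 0 then x else a i := by
      intro x
      funext i
      grind [insertAt]
    have : CompleteSpace I.toNonUnitalSubalgebra := I.isClosed.completeSpace_coe
    have h2 := hI.eq_zero_of_mul
      (((Cochain.evalCLM n b).comp (ins 0 F)).comp I.incl) fun x c => by
        change (ins 0 F ((x : A) * c)).seq b = 0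
        rw [ins_seq, Fin.val_zero, hb]
        let d : ℕ → A := fun i => if i = 0 then x else a i
        have h4 : (coboundary (n + 1) F).seq (insertAt 1 c d) = 0 := by
          rw [hFδ]
          exact hf _ 1 (by omega) (by omega) (by simp [insertAt])
        have h5 := ins_tailCoboundary F (c : A)
        rw [h1 _ c.2, map_zero, sub_zero] at h5
        have h6 := congrArg (fun h => Cochain.seq h d) h5
        simp only [ins_seq, Fin.val_one] at h6
        rw [coface_seq (by omega), hone _ (by
          simpa [mergeAt, insertAt] using I.mul_mem_right _ c.2), mul_zero] at h6
        rw [coboundary_eq_tail, LinearMap.add_apply, Cochain.add_seq, h6, zero_add,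
          coface_seq (by omega), pow_zero, one_mul] at h4
        rw [← h4]
        congr 1
        funext i
        grind [mergeAt, insertAt]
    have h3 := congrArg (fun φ : I.toNonUnitalSubalgebra →L[ℂ] ℂ => φ ⟨a 0, ha⟩) h2
    change (ins 0 F (a 0)).seq b = 0 at h3
    rw [ins_seq, Fin.val_zero, hb] at h3
    rw [← h3]
    congr 1
    funext i
    split_ifs with hi <;> simp [hi]
  intro a q hq _ h
  interval_cases q
  · exact hzero a h
  · exact hone a h

/-- Modulo cochains vanishing on an amenable ideal, the Hochschild complex is exact in positive
degrees. -/
theorem exists_sub_coboundary_mem_vanishing [CompleteSpace A]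
    (hI : IsAmenable I.toNonUnitalSubalgebra) {f : Cochain A (n + 1)}
    (hf : coboundary (n + 1) f ∈ vanishing I (n + 3) (n + 2)) :
    ∃ g : Cochain A n, f - coboundary n g ∈ vanishing I (n + 2) (n + 1) := by
  obtain ⟨E, hE⟩ := I.exists_isLeftMean hI
  have key : ∀ k ≤ n, ∃ g : Cochain A n, f - coboundary n g ∈ vanishing I (k + 2) (n + 1) := by
    intro k hk
    induction k with
    | zero => exact exists_sub_coboundary_mem_vanishing_two hI hf
    | succ k ih =>
      obtain ⟨g, hg⟩ := ih (by omega)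
      -- Slots `0, …, k + 1` are settled, so the next average is taken in slot `k + 2`.
      have h := sub_coboundary_avg_mem_vanishing hE (p := ⟨k + 2, by omega⟩) (by simp) hg
        (by rwa [map_sub, coboundary_coboundary, sub_zero])
      rw [sub_sub, ← map_add] at h
      exact ⟨_, h⟩
  exact key n le_rfl

end FirstPosition

/-! ### The relative cyclic complex -/

section Relative

variable {A : Type u} [NonUnitalNormedRing A] [NormedSpace ℂ A]
  [IsScalarTower ℂ A A] [SMulCommClass ℂ A A]

/-- Exactness in degree `n` of the quotient of the cyclic complex of `A` by the subcomplex of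
cochains vanishing on `I`. -/
def IsRelativelyExact (I : ClosedIdeal A) (n : ℕ) : Prop :=
  ∀ f ∈ cyclicCochains A n, coboundary n f ∈ vanishing I (n + 2) (n + 1) →
    ∃ h ∈ cyclicCoboundaries A n, f - h ∈ vanishing I (n + 1) n

/-- If `h = δ w` with `w` cyclic, then `y = b' w / (n + 1)` works, since `N b' w = δ N w = (n + 1) δ
w`. Subtracting such a `y` from a cochain changes its norm by `h` but not its image under `b'`. -/
theorem exists_normOp_eq_of_mem_cyclicCoboundaries : ∀ {n : ℕ} {h : Cochain A n},
    h ∈ cyclicCoboundaries A n → ∃ y, normOp n y = h ∧ barCoboundary n y = 0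
  | 0, h, hh => ⟨0, by rw [map_zero]; exact (show h = 0 from hh).symm, map_zero _⟩
  | n + 1, h, hh => by
    obtain ⟨w, hw, rfl⟩ := hh
    refine ⟨barCoboundary n (((n : ℂ) + 1)⁻¹ • w), ?_, barCoboundary_barCoboundary n _⟩
    rw [← coboundary_normOp, map_smul, normOp_of_cyclic hw,
      inv_smul_smul₀ (Nat.cast_add_one_ne_zero n)]

theorem coboundary_mem_cyclicCocycles {n : ℕ} {f : Cochain A n} (hf : f ∈ cyclicCochains A n) :
    coboundary n f ∈ cyclicCocycles A (n + 1) :=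
  ⟨coboundary_mem_cyclicCochains hf, coboundary_coboundary n f⟩

theorem cyclicCoboundaries_le_cyclicCocycles : ∀ n : ℕ,
    cyclicCoboundaries A n ≤ cyclicCocycles A n
  | 0 => bot_le
  | _ + 1 => by
    rintro _ ⟨f, hf, rfl⟩
    exact coboundary_mem_cyclicCocycles hf

variable {I : ClosedIdeal A} [CompleteSpace A]

omit [CompleteSpace A] in
theorem isRelativelyExact_zero (hI : HasNoNonzeroBoundedTrace I.toNonUnitalSubalgebra) :
    IsRelativelyExact I 0 := by
  intro f _ hδ
  refine ⟨0, Submodule.zero_mem _, ?_⟩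
  rw [sub_zero]
  let φ : A →L[ℂ] ℂ := f.toCMM.toContinuousLinearMap (fun _ => 0) 0
  have hφ : ∀ a : ℕ → A, f.seq a = φ (a 0) := fun a => by
    change f.toCMM _ = f.toCMM _
    congr 1
    funext i
    fin_cases i
    simp
  have h0 := hI (φ.comp I.incl) fun a b => by
    have h := hδ (fun i => if i = 0 then a else b) 0 (by omega) (by omega) (by simp)
    rw [coboundary_eq_bar, barCoboundary, Finset.sum_range_one, LinearMap.add_apply,
      Cochain.add_seq, coface_seq le_rfl, coface_last_seq, hφ, hφ] at h
    simp only [mergeAt, rotateSeq] at h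
    change φ ((a : A) * b) = φ ((b : A) * a)
    simpa [← sub_eq_add_neg, sub_eq_zero] using h
  intro a q _ hq h
  obtain rfl : q = 0 := by omega
  rw [hφ]
  exact congrArg (fun ψ : I.toNonUnitalSubalgebra →L[ℂ] ℂ => ψ ⟨a 0, h⟩) h0

/-- Relative Hochschild exactness suffices, as every `0`-cochain is cyclic. -/
theorem isRelativelyExact_one (hI : IsAmenable I.toNonUnitalSubalgebra) :
    IsRelativelyExact I 1 := by
  intro f _ hδ
  obtain ⟨g, hg⟩ := exists_sub_coboundary_mem_vanishing hI hδ
  refine ⟨_, ⟨g, mem_cyclicCochains_iff_rotOp.2 ?_, rfl⟩, hg⟩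
  simpa using LinearMap.congr_fun (rotOp_pow_card (A := A) 0) g

/-- A chase in the bicomplex. Modulo vanishing cochains write `f = δ g`, then `(1 - s) g = b' v`.
Exactness in degree `n` applies to `N v`, and this allows `g` to be replaced by a cyclic cochain `G`
with `f = δ G`. -/
theorem IsRelativelyExact.add_two (hA : HasLeftBAI A ∨ HasRightBAI A)
    (hI : IsAmenable I.toNonUnitalSubalgebra) {n : ℕ} (hn : IsRelativelyExact I n) :
    IsRelativelyExact I (n + 2) := by
  intro f hf hδ
  obtain ⟨g, hg⟩ := exists_sub_coboundary_mem_vanishing hI hδ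
  have hrot : ∀ {m : ℕ} (h : Cochain A m), (1 - rotOp m : Module.End ℂ (Cochain A m)) h =
    h - rotOp m h := fun _ => rfl
  have h1 : barCoboundary (n + 1) (g - rotOp (n + 1) g) ∈ vanishing I (n + 3) (n + 2) := by
    rw [← coboundary_sub_rotOp]
    have h2 := Submodule.sub_mem _ (rotOp_mem_vanishing hg) hg
    rw [map_sub, mem_cyclicCochains_iff_rotOp.1 hf] at h2
    convert h2 using 1
    abel
  obtain ⟨v, hv⟩ := exists_sub_barCoboundary_mem_vanishing hA h1
  obtain ⟨h, hh, hvh⟩ := hn (normOp n v) (normOp_mem_cyclicCochains n v) (by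
    rw [coboundary_normOp]
    have h2 := normOp_mem_vanishing hv
    rw [map_sub, map_sub, normOp_rotOp, sub_self, zero_sub] at h2
    exact neg_mem_iff.1 h2)
  obtain ⟨y, rfl, hy⟩ := exists_normOp_eq_of_mem_cyclicCoboundaries hh
  rw [← map_sub] at hvh
  -- Now `N z` vanishes on `I` while `b' z = b' v`, and hence `z = (1 - s) x` modulo vanishing
  -- cochains.
  set z := v - y with hz
  set x := ((n : ℂ) + 1)⁻¹ • normHomotopy n z with hx
  have hzx : z - (x - rotOp n x) = ((n : ℂ) + 1)⁻¹ • normOp n z := by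
    have h2 := LinearMap.congr_fun (one_sub_rotOp_mul_normHomotopy (A := A) n) z
    rw [Module.End.mul_apply, hrot, LinearMap.sub_apply, LinearMap.smul_apply,
      Module.End.one_apply] at h2
    rw [hx, map_smul, ← smul_sub, h2, smul_sub, inv_smul_smul₀ (Nat.cast_add_one_ne_zero n)]
    abel
  have h3 : barCoboundary n (z - (x - rotOp n x)) ∈ vanishing I (n + 2) (n + 1) := by
    rw [hzx]
    exact barCoboundary_mem_vanishing (Submodule.smul_mem _ _ hvh)
  -- Since `b' (1 - s) x = (1 - s) δ x`, this correction makes `g` invariant under rotation modulo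
  -- vanishing cochains, without changing `δ g`.
  set k := g - coboundary n x with hk
  have h4 : k - rotOp (n + 1) k ∈ vanishing I (n + 2) (n + 1) := by
    have h5 := Submodule.add_mem _ hv h3
    rw [map_sub, ← coboundary_sub_rotOp, hz, map_sub, hy] at h5
    rw [hk, map_sub]
    convert h5 using 1
    abel
  -- Averaging over the cyclic group makes `k` exactly cyclic; the difference is `normHomotopy`
  -- applied to `(1 - s) k`, up to a scalar.
  set G := (((n + 1 : ℕ) : ℂ) + 1)⁻¹ • normOp (n + 1) k with hG
  have h6 : k - G ∈ vanishing I (n + 2) (n + 1) := by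
    have h2 := LinearMap.congr_fun (normHomotopy_mul_one_sub_rotOp (A := A) (n + 1)) k
    rw [Module.End.mul_apply, hrot, LinearMap.sub_apply, LinearMap.smul_apply,
      Module.End.one_apply] at h2
    have h7 := Submodule.smul_mem _ (((n + 1 : ℕ) : ℂ) + 1)⁻¹ (normHomotopy_mem_vanishing h4)
    rwa [h2, smul_sub, inv_smul_smul₀ (Nat.cast_add_one_ne_zero (n + 1))] at h7
  refine ⟨coboundary (n + 1) G,
    ⟨G, Submodule.smul_mem _ _ (normOp_mem_cyclicCochains _ k), rfl⟩, ?_⟩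
  have h8 := Submodule.add_mem _ hg (coboundary_mem_vanishing h6)
  rw [map_sub, hk, map_sub, coboundary_coboundary] at h8
  convert h8 using 1
  abel

theorem isRelativelyExact_of_odd (hA : HasLeftBAI A ∨ HasRightBAI A)
    (hI : IsAmenable I.toNonUnitalSubalgebra) {n : ℕ} (hn : Odd n) : IsRelativelyExact I n := by
  obtain ⟨k, rfl⟩ := hn
  induction k with
  | zero => exact isRelativelyExact_one hI
  | succ k ih => exact ih.add_two hA hI

theorem isRelativelyExact_of_no_trace (hA : HasLeftBAI A ∨ HasRightBAI A)
    (hI : IsAmenable I.toNonUnitalSubalgebra)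
    (ht : HasNoNonzeroBoundedTrace I.toNonUnitalSubalgebra) (n : ℕ) : IsRelativelyExact I n := by
  rcases n.even_or_odd' with ⟨k, rfl | rfl⟩
  · induction k with
    | zero => exact isRelativelyExact_zero ht
    | succ k ih => exact ih.add_two hA hI
  · exact isRelativelyExact_of_odd hA hI ⟨k, rfl⟩

end Relative

/-! ### Descent to the quotient algebra -/

section Descent

variable {A : Type u} [NonUnitalNormedRing A] [NormedSpace ℂ A] {I : ClosedIdeal A}

theorem pullback_quotMap_injective (n : ℕ) : Function.Injective (pullback I.quotMap n) := by
  intro f g h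
  refine Cochain.ext fun q => ?_
  choose a ha using fun i => I.quotMap_surjective (q i)
  have h1 : f (fun i => I.quotMap (a i)) = g fun i => I.quotMap (a i) :=
    congrArg (fun f : Cochain A n => f a) h
  rwa [funext ha] at h1

/-- Expand `f(b + (a - b))` multilinearly: every term but `f b` has an argument `a i - b i` in `I`.
-/
theorem apply_eq_of_mem_vanishing {n : ℕ} {f : Cochain A n} (hf : f ∈ vanishing I (n + 1) n)
    {a b : Fin (n + 1) → A} (h : ∀ i, I.quotMap (a i) = I.quotMap (b i)) : f a = f b := by
  have hzero : ∀ (c : Fin (n + 1) → A) (i : Fin (n + 1)), c i ∈ I.sub → f c = 0 := by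
    intro c i hi
    obtain ⟨d, rfl⟩ := Cochain.exists_seq c
    exact hf d i i.2 (Nat.lt_succ_iff.1 i.2) hi
  have h1 := f.toCMM.toMultilinearMap.map_add_univ b (a - b)
  rw [add_sub_cancel, Finset.sum_eq_single Finset.univ] at h1
  · rw [Finset.piecewise_univ] at h1
    exact h1
  · intro s _ hs
    obtain ⟨i, hi⟩ : ∃ i, i ∉ s := by
      by_contra! hcon
      exact hs (Finset.eq_univ_iff_forall.2 hcon)
    refine hzero _ i ?_
    rw [Finset.piecewise_eq_of_notMem _ _ _ hi]
    exact I.quotMap_eq.1 (h i)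
  · simp

/-- Define the descended cochain by any set-theoretic section. Continuity follows because a finite
power of the open quotient map is again a quotient map. -/
theorem exists_pullback_eq_of_mem_vanishing [CompleteSpace A] {n : ℕ} {f : Cochain A n}
    (hf : f ∈ vanishing I (n + 1) n) : ∃ g : Cochain I.Quot n, pullback I.quotMap n g = f := by
  let s : I.Quot → A := Function.surjInv I.quotMap_surjective
  have hs : ∀ x, I.quotMap (s x) = x := Function.surjInv_eq I.quotMap_surjective
  let F : MultilinearMap ℂ (fun _ : Fin (n + 1) => I.Quot) ℂ := MultilinearMap.mk'
    (fun q => f fun i => s (q i))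
    (by
      intro q i x y
      have h : ∀ x' z, I.quotMap x' = z → f (fun j => s (Function.update q i z j)) =
          f.toCMM (Function.update (fun j => s (q j)) i x') := fun x' z hz => by
        refine apply_eq_of_mem_vanishing hf fun j => ?_
        by_cases hj : j = i
        · subst hj
          simp [hs, hz]
        · simp [hj]
      rw [h (s x) x (hs x), h (s y) y (hs y),
        h (s x + s y) (x + y) (by rw [map_add, hs, hs]), ContinuousMultilinearMap.map_update_add])
    (by
      intro q i c x
      have h : ∀ x' z, I.quotMap x' = z → f (fun j => s (Function.update q i z j)) =
          f.toCMM (Function.update (fun j => s (q j)) i x') := fun x' z hz => by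
        refine apply_eq_of_mem_vanishing hf fun j => ?_
        by_cases hj : j = i
        · subst hj
          simp [hs, hz]
        · simp [hj]
      rw [h (s x) x (hs x), h (c • s x) (c • x) (by rw [map_smul, hs]),
        ContinuousMultilinearMap.map_update_smul])
  have hF : ∀ a : Fin (n + 1) → A, F (fun i => I.quotMap (a i)) = f a := fun a =>
    apply_eq_of_mem_vanishing hf fun i => hs _
  have hquot : IsOpenQuotientMap (Pi.map fun _ : Fin (n + 1) => I.quotMap) :=
    IsOpenQuotientMap.piMap fun _ =>
      ⟨I.quotMap_surjective, I.quotMap.continuous, I.quotMap.isOpenMap I.quotMap_surjective⟩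
  have hcont : Continuous F := by
    rw [hquot.isQuotientMap.continuous_iff]
    exact f.toCMM.cont.congr fun a => (hF a).symm
  exact ⟨Cochain.ofCMM ⟨F, hcont⟩, Cochain.ext hF⟩

theorem exists_cyclic_pullback_eq [CompleteSpace A] {n : ℕ} {f : Cochain A n}
    (hf : f ∈ vanishing I (n + 1) n) (hc : f ∈ cyclicCochains A n) :
    ∃ g ∈ cyclicCochains I.Quot n, pullback I.quotMap n g = f := by
  obtain ⟨g, rfl⟩ := exists_pullback_eq_of_mem_vanishing hf
  refine ⟨g, pullback_quotMap_injective n ?_, rfl⟩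
  exact hc

theorem pullback_mem_vanishing {n : ℕ} (p : ℕ) (g : Cochain I.Quot n) :
    pullback I.quotMap n g ∈ vanishing I p n := by
  intro a q _ hq h
  refine g.toCMM.map_coord_zero ⟨q, Nat.lt_succ_iff.2 hq⟩ ?_
  have h1 := (I.quotMap_eq (x := a q) (y := 0)).2 (by simpa using h)
  rwa [map_zero] at h1

end Descent

/-! ### The natural map -/

section NaturalMap

variable {A : Type u} [NonUnitalNormedRing A] [NormedSpace ℂ A]
  [IsScalarTower ℂ A A] [SMulCommClass ℂ A A] {I : ClosedIdeal A}

theorem naturalMap_mk {n : ℕ} (z : cyclicCocycles I.Quot n) :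
    I.naturalMap n (Submodule.Quotient.mk z) = Submodule.Quotient.mk
      ⟨pullback I.quotMap n z, pullback_mem_cyclicCocycles I.quotMap I.quotMap_mul n z.2⟩ := rfl

theorem naturalMap_zero_injective : Function.Injective (I.naturalMap 0) := by
  rw [injective_iff_map_eq_zero]
  intro x hx
  obtain ⟨z, rfl⟩ := Submodule.Quotient.mk_surjective _ x
  rw [naturalMap_mk, Submodule.Quotient.mk_eq_zero] at hx
  have h : pullback I.quotMap 0 z.1 = 0 := hx
  have hz : z = 0 := Subtype.ext (pullback_quotMap_injective 0 (h.trans (map_zero _).symm))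
  rw [hz, Submodule.Quotient.mk_zero]

variable [CompleteSpace A]

/-- If the pullback of `z` is `δ g`, exactness lets `g` be changed by a coboundary so that it
descends to `A / I`; there its coboundary is `z`. -/
theorem IsRelativelyExact.naturalMap_injective {n : ℕ} (hn : IsRelativelyExact I n) :
    Function.Injective (I.naturalMap (n + 1)) := by
  rw [injective_iff_map_eq_zero]
  intro x hx
  obtain ⟨z, rfl⟩ := Submodule.Quotient.mk_surjective _ x
  rw [naturalMap_mk, Submodule.Quotient.mk_eq_zero] at hx
  obtain ⟨g, hg, hgz⟩ : ∃ g ∈ cyclicCochains A n, coboundary n g = pullback I.quotMap (n + 1) z :=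
    hx
  obtain ⟨h, hh, hgh⟩ := hn g hg (by rw [hgz]; exact pullback_mem_vanishing _ _)
  have hh' := cyclicCoboundaries_le_cyclicCocycles n hh
  obtain ⟨k, hk, hkg⟩ := exists_cyclic_pullback_eq hgh (Submodule.sub_mem _ hg hh'.1)
  rw [Submodule.Quotient.mk_eq_zero]
  refine ⟨k, hk, pullback_quotMap_injective (n + 1) ?_⟩
  rw [pullback_coboundary _ I.quotMap_mul, hkg, map_sub, show coboundary n h = 0 from hh'.2,
    sub_zero, hgz]
  rfl

/-- A cocycle on `A` is vanishing on `I` up to a coboundary, so it is cohomologous to a pullback. -/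
theorem IsRelativelyExact.naturalMap_surjective {n : ℕ} (hn : IsRelativelyExact I n) :
    Function.Surjective (I.naturalMap n) := by
  intro x
  obtain ⟨z, rfl⟩ := Submodule.Quotient.mk_surjective _ x
  obtain ⟨h, hh, hzh⟩ := hn z z.2.1 (by
    rw [show coboundary n z.1 = 0 from z.2.2]
    exact Submodule.zero_mem _)
  have hh' := cyclicCoboundaries_le_cyclicCocycles n hh
  obtain ⟨k, hk, hkz⟩ := exists_cyclic_pullback_eq hzh (Submodule.sub_mem _ z.2.1 hh'.1)
  have hkδ : coboundary n k = 0 := by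
    refine pullback_quotMap_injective (n + 1) ?_
    rw [pullback_coboundary _ I.quotMap_mul, hkz, map_sub, show coboundary n h = 0 from hh'.2,
      show coboundary n z.1 = 0 from z.2.2, sub_zero, map_zero]
  refine ⟨Submodule.Quotient.mk ⟨k, hk, hkδ⟩, ?_⟩
  rw [naturalMap_mk, Submodule.Quotient.eq]
  change pullback I.quotMap n k - z.1 ∈ cyclicCoboundaries A n
  rw [hkz, sub_sub_cancel_left]
  exact Submodule.neg_mem _ hh

omit [IsScalarTower ℂ A A] [SMulCommClass ℂ A A] [CompleteSpace A] in
theorem isClosed_cyclicCochains (n : ℕ) : IsClosed (cyclicCochains A n : Set (Cochain A n)) :=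
  isClosed_eq (continuous_cyclicOp n) continuous_id

omit [CompleteSpace A] in
theorem isClosed_cyclicCocycles (n : ℕ) : IsClosed (cyclicCocycles A n : Set (Cochain A n)) :=
  (isClosed_cyclicCochains n).inter (isClosed_eq (continuous_coboundary n) continuous_const)

omit [CompleteSpace A] in
theorem continuous_naturalMap (n : ℕ) : Continuous (I.naturalMap n) := by
  refine continuous_quot_lift _ ?_
  exact continuous_quot_mk.comp
    (((continuous_pullback I.quotMap n).comp continuous_subtype_val).subtype_mk _)

-- The coboundaries need not be closed, so the open mapping theorem is applied one level up, to `(z,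
-- y) ↦ θ^* z + β y` from cocycles of `A / I` times `Y` onto cocycles of `A`, where `β` parametrizes
-- the coboundaries by a Banach space. The quotient map onto cohomology is open in any case.
omit [CompleteSpace A] in
set_option maxSynthPendingDepth 3 in
theorem isOpenMap_naturalMap {n : ℕ} (h : Function.Surjective (I.naturalMap n))
    {Y : Type*} [NormedAddCommGroup Y] [NormedSpace ℂ Y] [CompleteSpace Y]
    (β : Y →L[ℂ] Cochain A n) (hβ : LinearMap.range β.toLinearMap = cyclicCoboundaries A n) :
    IsOpenMap (I.naturalMap n) := by
  have : CompleteSpace (cyclicCocycles I.Quot n) :=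
    (isClosed_cyclicCocycles n).completeSpace_coe
  have : CompleteSpace (cyclicCocycles A n) :=
    (isClosed_cyclicCocycles n).completeSpace_coe
  have hβmem : ∀ y, β y ∈ cyclicCoboundaries A n := fun y => hβ ▸ ⟨y, rfl⟩
  let κ : Cochain I.Quot n →L[ℂ] Cochain A n := ⟨pullback I.quotMap n, continuous_pullback _ n⟩
  let Φ : cyclicCocycles I.Quot n × Y →L[ℂ] cyclicCocycles A n :=
    ((κ.comp (cyclicCocycles I.Quot n).subtypeL).coprod β).codRestrict _ fun x =>
      Submodule.add_mem _ (pullback_mem_cyclicCocycles I.quotMap I.quotMap_mul n x.1.2)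
        (cyclicCoboundaries_le_cyclicCocycles n (hβmem _))
  have hΦ : ∀ x, (Submodule.Quotient.mk (Φ x) : HC A n) =
      I.naturalMap n (Submodule.Quotient.mk x.1) := fun x => by
    rw [naturalMap_mk, Submodule.Quotient.eq]
    change pullback I.quotMap n x.1 + β x.2 - pullback I.quotMap n x.1 ∈ cyclicCoboundaries A n
    rw [add_sub_cancel_left]
    exact hβmem _
  have hsurj : Function.Surjective Φ := fun c => by
    obtain ⟨x, hx⟩ := h (Submodule.Quotient.mk c)
    obtain ⟨z, rfl⟩ := Submodule.Quotient.mk_surjective _ x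
    rw [naturalMap_mk, eq_comm, Submodule.Quotient.eq] at hx
    obtain ⟨y, hy⟩ : ∃ y, β y = c.1 - pullback I.quotMap n z := by
      have h1 : c.1 - pullback I.quotMap n z ∈ cyclicCoboundaries A n := hx
      rw [← hβ] at h1
      exact h1
    refine ⟨(z, y), Subtype.ext ?_⟩
    change pullback I.quotMap n z + β y = c.1
    rw [hy, add_sub_cancel]
  intro U hU
  have hUimage : I.naturalMap n '' U = (fun c => (Submodule.Quotient.mk c : HC A n)) ''
      (Φ '' ((fun x => (Submodule.Quotient.mk x.1 : HC I.Quot n)) ⁻¹' U)) := by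
    rw [Set.image_image]
    simp only [hΦ]
    ext w
    constructor
    · rintro ⟨x, hx, rfl⟩
      obtain ⟨z, rfl⟩ := Submodule.Quotient.mk_surjective _ x
      exact ⟨(z, 0), hx, rfl⟩
    · rintro ⟨x, hx, rfl⟩
      exact ⟨_, hx, rfl⟩
  rw [hUimage]
  refine QuotientAddGroup.isOpenMap_coe _ (Φ.isOpenMap hsurj _ ?_)
  exact hU.preimage (continuous_quot_mk.comp continuous_fst)

omit [CompleteSpace A] in
theorem exists_continuousLinearEquiv_naturalMap {n : ℕ}
    (h : Function.Bijective (I.naturalMap n)) :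
    ∃ e : HC I.Quot n ≃L[ℂ] HC A n, ∀ x, e x = I.naturalMap n x := by
  have hopen : IsOpenMap (I.naturalMap n) := by
    cases n with
    | zero =>
      refine isOpenMap_naturalMap h.2 (Y := ℂ) 0 ?_
      exact LinearMap.range_zero
    | succ n =>
      have : CompleteSpace (cyclicCochains A n) := (isClosed_cyclicCochains n).completeSpace_coe
      refine isOpenMap_naturalMap h.2 (Y := cyclicCochains A n)
        ⟨(coboundary n).domRestrict _, (continuous_coboundary n).comp continuous_subtype_val⟩ ?_
      exact LinearMap.range_domRestrict _ _
  let e := LinearEquiv.ofBijective (I.naturalMap n) h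
  refine ⟨{ e with
    continuous_toFun := continuous_naturalMap n
    continuous_invFun := continuous_def.2 fun U hU => ?_ }, fun _ => rfl⟩
  have h1 : e.symm ⁻¹' U = I.naturalMap n '' U := (e.toEquiv.image_eq_preimage_symm U).symm
  change IsOpen (e.symm ⁻¹' U)
  rw [h1]
  exact hopen U hU

end NaturalMap

end

end BanachCyclic

theorem theorem4p2 {A : Type*} [NonUnitalNormedRing A] [NormedSpace ℂ A] [IsScalarTower ℂ A A]
    [SMulCommClass ℂ A A] [CompleteSpace A]
    (hA : BanachCyclic.HasLeftBAI A ∨ BanachCyclic.HasRightBAI A)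
    (I : BanachCyclic.ClosedIdeal A)
    (hI : BanachCyclic.IsAmenable I.toNonUnitalSubalgebra) :
    ((∀ n : ℕ, Even n → Function.Injective (I.naturalMap n)) ∧
      (∀ n : ℕ, Odd n → Function.Surjective (I.naturalMap n))) ∧
    (BanachCyclic.HasNoNonzeroBoundedTrace I.toNonUnitalSubalgebra →
      ∀ n : ℕ, ∃ e : BanachCyclic.HC I.Quot n ≃L[ℂ] BanachCyclic.HC A n,
        ∀ x, e x = I.naturalMap n x) := by
  refine ⟨⟨fun n hn => ?_, fun n hn =>
    (BanachCyclic.isRelativelyExact_of_odd hA hI hn).naturalMap_surjective⟩, fun ht n => ?_⟩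
  · cases n with
    | zero => exact BanachCyclic.naturalMap_zero_injective
    | succ n =>
      -- Injectivity in an even positive degree uses exactness in the odd degree below it.
      exact (BanachCyclic.isRelativelyExact_of_odd hA hI
        (Nat.not_even_iff_odd.1 (Nat.even_add_one.1 hn))).naturalMap_injective
  · have hex := BanachCyclic.isRelativelyExact_of_no_trace hA hI ht
    refine BanachCyclic.exists_continuousLinearEquiv_naturalMap ⟨?_, (hex n).naturalMap_surjective⟩
    cases n with
    | zero => exact BanachCyclic.naturalMap_zero_injective
    | succ n => exact (hex n).naturalMap_injective
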